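/- A complex Lie superalgebra of dimension $m|n$ is a $\mathbb Z/2$-graded complex vector space $L=L_0\oplus L_1$ with $\dim L_0=m$, $\dim L_1=n$, together with an even bilinear bracket satisfying the graded antisymmetry and graded Jacobi identities; homomorphisms are even (parity preserving) linear maps compatible with the brackets. Let $L$ have basis $f,e_2,e_3,e_4$ with $f$ odd and $e_2,e_3,e_4$ even, and let $v_1=\pi f$ (even) and $v_i=\pi e_i$ (odd, $i=2,3,4$) be the corresponding basis of the parity reversion $\Pi L$. For $i\le j$ let $\psi^{i,j}_k\colon S^2(\Pi L)\to \Pi L$ be the linear map that sends $v_iv_j$ to $v_k$ and every other quadratic monomial to $0$. An odd codifferential $d$ defines a Lie superalgebra on $L$ with the bracket $[a,b]=(-1)^{|a|}\,\pi^{-1} d(\pi a\cdot \pi b)$ for homogeneous $a$. The following codifferentials, with $p,q,r\in\mathbb C$ arbitrary, define Lie superalgebras of dimension $3|1$: $$\begin{aligned} d_1&=\psi^{2,3}_4+\psi^{2,4}_3+\psi^{3,4}_2,\\ d_2(p:q)&=8\psi^{1,1}_2+p\,\psi^{1,4}_1-2p\,\psi^{2,4}_2+\psi^{3,4}_2+q\,\psi^{3,4}_3,\\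 d_3&=8\psi^{1,1}_2+\psi^{1,4}_1-2\psi^{2,4}_2-2\psi^{3,4}_3,\\ d_4&=8\psi^{1,1}_2,\\ d_5&=\psi^{2,3}_2+\psi^{1,4}_1,\\ d_6(p:q:r)&=p\,\psi^{1,4}_1+q\,\psi^{2,4}_2+\psi^{3,4}_2+r\,\psi^{3,4}_3,\\ d_7(p:q)&=p\,\psi^{1,4}_1+q\,\psi^{2,4}_2+q\,\psi^{3,4}_3 . \end{aligned}$$ 1. Every complex Lie superalgebra of dimension $3|1$ is isomorphic to one of these algebras. 2. The only isomorphisms among them are the following: $d_2(p:q)\cong d_2(p':q')$ if and only if $(p',q')=t(p,q)$ for some $t\neq0$; $d_7(p:q)\cong d_7(p':q')$ if and only if $(p',q')=t(p,q)$ for some $t\neq0$; $d_6(p:q:r)\cong d_6(p':q':r')$ if and only if $(p',q',r')=t(p,q,r)$ or $(p',q',r')=t(p,r,q)$ for some $t\ne0$; algebras with different labels $d_1,\dots,d_7$ are not isomorphic. Thus $d_2$ and $d_7$ are parametrized by $\mathbb P^1$ and $d_6$ by $\mathbb P^2/\Sigma_2$ (where $\Sigma_2$ interchanges the last two coordinates),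 each together with the additional ("generic") point at which all the parameters vanish. 3. $d_1$ is not solvable, and it is an extension of $\mathfrak{sl}(2,\mathbb C)$ by the trivial $0|1$-dimensional algebra, that is, there is an exact sequence $0\to M\to d_1\to\mathfrak{sl}(2,\mathbb C)\to0$ of Lie superalgebras with $M$ the trivial algebra of dimension $0|1$. 4. Every $3|1$-dimensional complex Lie superalgebra $L$ that is not isomorphic to $d_1$ is solvable, and is an extension $0\to M\to L\to W\to 0$ of the trivial $1|0$-dimensional algebra $W$ by a solvable Lie superalgebra $M$ of dimension $2|1$. -/

import Mathlib

universe u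

/-- The Koszul sign `(-1)^(i*j)` of two parities. -/
def koszulSign (i j : ZMod 2) : ℂ := if i = 1 ∧ j = 1 then -1 else 1

theorem zmod_two_eq (i : ZMod 2) : i = 0 ∨ i = 1 := by
  revert i; decide

theorem zmod_two_add : (1 : ZMod 2) + 1 = 0 := by decide

/-- A complex Lie superalgebra structure on the vector space `L`: a grading by `ℤ/2`
(`grade 0` is the even part, `grade 1` the odd part) and an even bilinear bracket which is
graded antisymmetric and satisfies the graded Jacobi identity. -/
structure LieSuperalgebra (L : Type*) [AddCommGroup L] [Module ℂ L] where
  grade : ZMod 2 → Submodule ℂ L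
  isCompl : IsCompl (grade 0) (grade 1)
  bracket : L →ₗ[ℂ] L →ₗ[ℂ] L
  bracket_mem : ∀ (i j : ZMod 2) (x y : L), x ∈ grade i → y ∈ grade j →
    bracket x y ∈ grade (i + j)
  skew : ∀ (i j : ZMod 2) (x y : L), x ∈ grade i → y ∈ grade j →
    bracket x y = -(koszulSign i j • bracket y x)
  jacobi : ∀ (i j k : ZMod 2) (x y z : L), x ∈ grade i → y ∈ grade j → z ∈ grade k →
    bracket x (bracket y z) =
      bracket (bracket x y) z + koszulSign i j • bracket y (bracket x z)

namespace LieSuperalgebra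

variable {L M W : Type*} [AddCommGroup L] [Module ℂ L] [AddCommGroup M] [Module ℂ M]
  [AddCommGroup W] [Module ℂ W]

/-- The (finite) bidimension of `A` is `m|n`. -/
def HasBidim (A : LieSuperalgebra L) (m n : ℕ) : Prop :=
  FiniteDimensional ℂ L ∧ Module.finrank ℂ (A.grade 0) = m ∧ Module.finrank ℂ (A.grade 1) = n

/-- A linear map is a (parity preserving) homomorphism of Lie superalgebras. -/
def IsHom (A : LieSuperalgebra L) (B : LieSuperalgebra M) (f : L →ₗ[ℂ] M) : Prop :=
  (∀ (i : ZMod 2) (x : L), x ∈ A.grade i → f x ∈ B.grade i) ∧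
    ∀ x y : L, f (A.bracket x y) = B.bracket (f x) (f y)

/-- `A` and `B` are isomorphic Lie superalgebras. -/
def Isomorphic (A : LieSuperalgebra L) (B : LieSuperalgebra M) : Prop :=
  ∃ e : L ≃ₗ[ℂ] M, IsHom A B e.toLinearMap

/-- `A` is an extension of `C` by `B`: there is an exact sequence `0 → B → A → C → 0` of Lie
superalgebras. -/
def IsExtension (A : LieSuperalgebra L) (C : LieSuperalgebra W) (B : LieSuperalgebra M) : Prop :=
  ∃ (f : M →ₗ[ℂ] L) (g : L →ₗ[ℂ] W), IsHom B A f ∧ IsHom A C g ∧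
    Function.Injective f ∧ Function.Exact f g ∧ Function.Surjective g

/-- The derived series: each term is the span of the brackets of elements of the preceding one. -/
def derivedSeries (A : LieSuperalgebra L) : ℕ → Submodule ℂ L
  | 0 => ⊤
  | n + 1 => Submodule.map₂ A.bracket (derivedSeries A n) (derivedSeries A n)

/-- `A` is solvable. -/
def IsSolvable (A : LieSuperalgebra L) : Prop := ∃ n : ℕ, A.derivedSeries n = ⊥

/-- The trivial algebra of bidimension `m|n`, with zero bracket. -/
def trivialAlgebra (m n : ℕ) : LieSuperalgebra ((Fin m → ℂ) × (Fin n → ℂ)) where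
  grade i := if i = 0 then LinearMap.ker (LinearMap.snd ℂ (Fin m → ℂ) (Fin n → ℂ))
    else LinearMap.ker (LinearMap.fst ℂ (Fin m → ℂ) (Fin n → ℂ))
  isCompl := by
    rw [if_pos rfl, if_neg one_ne_zero, LinearMap.ker_snd, LinearMap.ker_fst]
    exact LinearMap.isCompl_range_inl_inr
  bracket := 0
  bracket_mem := by intros; simp
  skew := by intros; simp
  jacobi := by intros; simp

/-- An ordinary Lie algebra, as a Lie superalgebra concentrated in even degree. -/
def ofLieAlgebra (g : Type*) [LieRing g] [LieAlgebra ℂ g] : LieSuperalgebra g where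
  grade i := if i = 0 then ⊤ else ⊥
  isCompl := by
    rw [if_pos rfl, if_neg one_ne_zero]
    exact isCompl_top_bot
  bracket := (LieModule.toEnd ℂ g g : g →ₗ[ℂ] Module.End ℂ g)
  bracket_mem := by
    intro i j x y hx hy
    rcases zmod_two_eq i with rfl | rfl <;> rcases zmod_two_eq j with rfl | rfl <;> simp_all
  skew := by
    intro i j x y hx hy
    rcases zmod_two_eq i with rfl | rfl <;> rcases zmod_two_eq j with rfl | rfl <;>
      simp_all [koszulSign]
  jacobi := by
    intro i j k x y z hx hy hz
    rcases zmod_two_eq i with rfl | rfl <;> rcases zmod_two_eq j with rfl | rfl <;>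
      simp_all [koszulSign]

/-- The simple Lie algebra `sl(2, ℂ)`, of bidimension `3|0`. -/
def sl2 : LieSuperalgebra (LieAlgebra.SpecialLinear.sl (Fin 2) ℂ) :=
  ofLieAlgebra (LieAlgebra.SpecialLinear.sl (Fin 2) ℂ)

end LieSuperalgebra

/-! ### The list of algebras

The space `ΠL` of bidimension `1|3` has the basis `v₁, v₂, v₃, v₄` (here with indices
`0, 1, 2, 3`), with `v₁` even and the others odd. In `L` itself the parities are reversed. -/

/-- The parity in `ΠL` of a basis vector. -/
def parityPi (i : Fin 4) : ZMod 2 := if i = 0 then 0 else 1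

/-- The elementary graded symmetric map `ψ^{i,j}_k : S²(ΠL) → ΠL`, seen as a bilinear map: it
sends `vᵢ · vⱼ` to `vₖ`, and the other products of two basis vectors, except for
`vⱼ · vᵢ = ± vᵢ · vⱼ`, to zero. -/
noncomputable def psi (i j k : Fin 4) : (Fin 4 → ℂ) →ₗ[ℂ] (Fin 4 → ℂ) →ₗ[ℂ] (Fin 4 → ℂ) :=
  LinearMap.mk₂ ℂ
    (fun x y => Pi.single k (if i = j then x i * y i
      else x i * y j + koszulSign (parityPi i) (parityPi j) * (x j * y i)))
    (by intro x x' y; rw [← Pi.single_add]; congr 1; split_ifs <;> simp <;> ring)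
    (by intro c x y; rw [← Pi.single_smul]; congr 1; split_ifs <;> simp <;> ring)
    (by intro x y y'; rw [← Pi.single_add]; congr 1; split_ifs <;> simp <;> ring)
    (by intro c x y; rw [← Pi.single_smul]; congr 1; split_ifs <;> simp <;> ring)

/-- The grading of `L`: the parity of each basis vector is the reverse of its parity in `ΠL`. -/
def gradeL (i : ZMod 2) : Submodule ℂ (Fin 4 → ℂ) where
  carrier := {x | ∀ a : Fin 4, parityPi a + 1 ≠ i → x a = 0}
  add_mem' := by intro x y hx hy a ha; simp [hx a ha, hy a ha]
  zero_mem' := by intro a _; rfl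
  smul_mem' := by intro c x hx a ha; simp [hx a ha]

theorem mem_gradeL (i : ZMod 2) (x : Fin 4 → ℂ) :
    x ∈ gradeL i ↔ (i ≠ 1 → x 0 = 0) ∧ (i ≠ 0 → x 1 = 0 ∧ x 2 = 0 ∧ x 3 = 0) := by
  constructor
  · intro h
    refine ⟨fun hi => h 0 ?_, fun hi => ⟨h 1 ?_, h 2 ?_, h 3 ?_⟩⟩ <;>
      rcases zmod_two_eq i with rfl | rfl <;> first | exact absurd rfl hi | decide
  · rintro ⟨h0, h1⟩ a ha
    rcases zmod_two_eq i with rfl | rfl <;> fin_cases a <;> simp_all [parityPi, zmod_two_add]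

/-- The operator `a ↦ (-1)^a a` on `L`, where the sign is given by the parity of `a` in `L`. -/
noncomputable def paritySign : (Fin 4 → ℂ) →ₗ[ℂ] (Fin 4 → ℂ) :=
  LinearMap.pi fun a => koszulSign (parityPi a + 1) 1 • LinearMap.proj a

theorem paritySign_zero (x : Fin 4 → ℂ) : paritySign x 0 = -x 0 := by
  simp [paritySign, koszulSign, parityPi]

theorem paritySign_succ (x : Fin 4 → ℂ) (a : Fin 4) (ha : a ≠ 0) : paritySign x a = x a := by
  simp [paritySign, koszulSign, parityPi, ha]

theorem psi_apply_zero (k : Fin 4) (x y : Fin 4 → ℂ) :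
    psi 0 0 k x y = Pi.single k (x 0 * y 0) := by
  simp [psi]

theorem psi_apply_one (j k : Fin 4) (x y : Fin 4 → ℂ) (hj : j ≠ 0) :
    psi 0 j k x y = Pi.single k (x 0 * y j + x j * y 0) := by
  simp [psi, koszulSign, parityPi, hj.symm]

theorem psi_apply_two (i j k : Fin 4) (x y : Fin 4 → ℂ) (hi : i ≠ 0) (hj : j ≠ 0) (h : i ≠ j) :
    psi i j k x y = Pi.single k (x i * y j - x j * y i) := by
  simp [psi, koszulSign, parityPi, hi, hj, h, sub_eq_add_neg]

/-- The labels of the algebras: four singletons and three families. -/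
inductive ModuliPoint : Type
  | d1 : ModuliPoint
  | d2 (p q : ℂ) : ModuliPoint
  | d3 : ModuliPoint
  | d4 : ModuliPoint
  | d5 : ModuliPoint
  | d6 (p q r : ℂ) : ModuliPoint
  | d7 (p q : ℂ) : ModuliPoint

namespace ModuliPoint

/-- The codifferential of each of the algebras (`v₁, v₂, v₃, v₄` have indices `0, 1, 2, 3`). -/
noncomputable def codifferential :
    ModuliPoint → ((Fin 4 → ℂ) →ₗ[ℂ] (Fin 4 → ℂ) →ₗ[ℂ] (Fin 4 → ℂ))
  | d1 => psi 1 2 3 + psi 1 3 2 + psi 2 3 1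
  | d2 p q => (8 : ℂ) • psi 0 0 1 + p • psi 0 3 0 - (2 * p) • psi 1 3 1 + psi 2 3 1
      + q • psi 2 3 2
  | d3 => (8 : ℂ) • psi 0 0 1 + psi 0 3 0 - (2 : ℂ) • psi 1 3 1 - (2 : ℂ) • psi 2 3 2
  | d4 => (8 : ℂ) • psi 0 0 1
  | d5 => psi 1 2 1 + psi 0 3 0
  | d6 p q r => p • psi 0 3 0 + q • psi 1 3 1 + psi 2 3 1 + r • psi 2 3 2
  | d7 p q => p • psi 0 3 0 + q • psi 1 3 1 + q • psi 2 3 2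

theorem codifferential_d1 (x y : Fin 4 → ℂ) : codifferential d1 (paritySign x) y =
    ![0, x 2 * y 3 - x 3 * y 2, x 1 * y 3 - x 3 * y 1, x 1 * y 2 - x 2 * y 1] := by
  funext a
  fin_cases a <;> simp [codifferential, psi_apply_two, paritySign_succ]

theorem codifferential_d2 (p q : ℂ) (x y : Fin 4 → ℂ) :
    codifferential (d2 p q) (paritySign x) y =
      ![p * (x 3 * y 0 - x 0 * y 3),
        -8 * (x 0 * y 0) - 2 * p * (x 1 * y 3 - x 3 * y 1) + (x 2 * y 3 - x 3 * y 2),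
        q * (x 2 * y 3 - x 3 * y 2), 0] := by
  funext a
  fin_cases a <;> simp [codifferential, psi_apply_zero, psi_apply_one, psi_apply_two,
    paritySign_zero, paritySign_succ, -mul_eq_mul_left_iff] <;> ring

theorem codifferential_d3 (x y : Fin 4 → ℂ) : codifferential d3 (paritySign x) y =
    ![x 3 * y 0 - x 0 * y 3, -8 * (x 0 * y 0) - 2 * (x 1 * y 3 - x 3 * y 1),
      -2 * (x 2 * y 3 - x 3 * y 2), 0] := by
  funext a
  fin_cases a <;> simp [codifferential, psi_apply_zero, psi_apply_one, psi_apply_two,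
    paritySign_zero, paritySign_succ, -mul_eq_mul_left_iff] <;> ring

theorem codifferential_d4 (x y : Fin 4 → ℂ) : codifferential d4 (paritySign x) y =
    ![0, -8 * (x 0 * y 0), 0, 0] := by
  funext a
  fin_cases a <;> simp [codifferential, psi_apply_zero, paritySign_zero]

theorem codifferential_d5 (x y : Fin 4 → ℂ) : codifferential d5 (paritySign x) y =
    ![x 3 * y 0 - x 0 * y 3, x 1 * y 2 - x 2 * y 1, 0, 0] := by
  funext a
  fin_cases a <;> simp [codifferential, psi_apply_one, psi_apply_two,
    paritySign_zero, paritySign_succ]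
  ring

theorem codifferential_d6 (p q r : ℂ) (x y : Fin 4 → ℂ) :
    codifferential (d6 p q r) (paritySign x) y =
      ![p * (x 3 * y 0 - x 0 * y 3),
        q * (x 1 * y 3 - x 3 * y 1) + (x 2 * y 3 - x 3 * y 2),
        r * (x 2 * y 3 - x 3 * y 2), 0] := by
  funext a
  fin_cases a <;> simp [codifferential, psi_apply_one, psi_apply_two,
    paritySign_zero, paritySign_succ, -mul_eq_mul_left_iff]
  ring

theorem codifferential_d7 (p q : ℂ) (x y : Fin 4 → ℂ) :
    codifferential (d7 p q) (paritySign x) y =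
      ![p * (x 3 * y 0 - x 0 * y 3), q * (x 1 * y 3 - x 3 * y 1),
        q * (x 2 * y 3 - x 3 * y 2), 0] := by
  funext a
  fin_cases a <;> simp [codifferential, psi_apply_one, psi_apply_two,
    paritySign_zero, paritySign_succ, -mul_eq_mul_left_iff]
  ring

set_option maxHeartbeats 4000000 in
/-- The Lie superalgebra with a given label. The bracket is `ℓ(a, b) = (-1)^a d(πa · πb)`. -/
noncomputable def algebra (m : ModuliPoint) : LieSuperalgebra (Fin 4 → ℂ) where
  grade := gradeL
  isCompl := by
    constructor
    · rw [Submodule.disjoint_def]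
      intro x h0 h1
      funext a
      fin_cases a
      · exact h0 0 (by decide)
      · exact h1 1 (by decide)
      · exact h1 2 (by decide)
      · exact h1 3 (by decide)
    · rw [codisjoint_iff, eq_top_iff]
      intro x _
      rw [Submodule.mem_sup]
      refine ⟨fun a => if a = 0 then 0 else x a, ?_, fun a => if a = 0 then x a else 0, ?_, ?_⟩
      · intro a ha
        fin_cases a <;> revert ha <;> simp [parityPi, zmod_two_add]
      · intro a ha
        fin_cases a <;> revert ha <;> simp [parityPi, zmod_two_add]
      · funext a
        fin_cases a <;> simp
  bracket := m.codifferential ∘ₗ paritySign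
  bracket_mem := by
    intro i j x y hx hy
    rw [mem_gradeL] at hx hy ⊢
    rcases zmod_two_eq i with rfl | rfl <;>
    rcases zmod_two_eq j with rfl | rfl <;>
    simp only [ne_eq, not_true_eq_false, false_imp_iff, zero_ne_one, one_ne_zero,
        not_false_eq_true, true_imp_iff, zmod_two_add, add_zero, zero_add, true_and, and_true] at * <;>
    cases m <;>
    simp only [LinearMap.comp_apply, codifferential_d1, codifferential_d2, codifferential_d3,
        codifferential_d4, codifferential_d5, codifferential_d6, codifferential_d7] <;>
    simp [*]
  skew := by
    intro i j x y hx hy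
    rw [mem_gradeL] at hx hy
    rcases zmod_two_eq i with rfl | rfl <;>
    rcases zmod_two_eq j with rfl | rfl <;>
    simp only [ne_eq, not_true_eq_false, false_imp_iff, zero_ne_one, one_ne_zero,
        not_false_eq_true, true_imp_iff, zmod_two_add, add_zero, zero_add, true_and, and_true] at * <;>
    cases m <;>
    simp only [LinearMap.comp_apply, codifferential_d1, codifferential_d2, codifferential_d3,
        codifferential_d4, codifferential_d5, codifferential_d6, codifferential_d7] <;>
    ext a <;> fin_cases a <;> simp [koszulSign, *, -mul_eq_mul_left_iff] <;> ring
  jacobi := by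
    intro i j k x y z hx hy hz
    rw [mem_gradeL] at hx hy hz
    rcases zmod_two_eq i with rfl | rfl <;>
    rcases zmod_two_eq j with rfl | rfl <;>
    rcases zmod_two_eq k with rfl | rfl <;>
    simp only [ne_eq, not_true_eq_false, false_imp_iff, zero_ne_one, one_ne_zero,
        not_false_eq_true, true_imp_iff, zmod_two_add, add_zero, zero_add, true_and, and_true] at * <;>
    cases m <;>
    simp only [LinearMap.comp_apply, codifferential_d1, codifferential_d2, codifferential_d3,
        codifferential_d4, codifferential_d5, codifferential_d6, codifferential_d7] <;>
    ext a <;> fin_cases a <;> simp [koszulSign, *, -mul_eq_mul_left_iff] <;> ring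

/-- Two labels are identified if they are the same singleton, or two points of the same family
with proportional parameters (by a nonzero factor); in the family `d6` the last two parameters
may moreover be interchanged. So `d2` and `d7` are parametrized by `ℙ¹`, and `d6` by `ℙ²/Σ₂`,
each together with the additional point at which all the parameters vanish. -/
def Same : ModuliPoint → ModuliPoint → Prop
  | d1, d1 => True
  | d2 p q, d2 p' q' => ∃ t : ℂ, t ≠ 0 ∧ p' = t * p ∧ q' = t * q
  | d3, d3 => True
  | d4, d4 => True
  | d5, d5 => True
  | d6 p q r, d6 p' q' r' => ∃ t : ℂ, t ≠ 0 ∧ p' = t * p ∧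
      ((q' = t * q ∧ r' = t * r) ∨ (q' = t * r ∧ r' = t * q))
  | d7 p q, d7 p' q' => ∃ t : ℂ, t ≠ 0 ∧ p' = t * p ∧ q' = t * q
  | _, _ => False

end ModuliPoint

section Triples

variable {V : Type*} [AddCommGroup V] [Module ℂ V] {x y z : V}

theorem linearIndependent_triple_iff : LinearIndependent ℂ ![x, y, z] ↔
    ∀ a b c : ℂ, a • x + b • y + c • z = 0 → a = 0 ∧ b = 0 ∧ c = 0 := by
  rw [Fintype.linearIndependent_iff]
  constructor
  · intro h a b c habc
    have := h ![a, b, c] (by simpa [Fin.sum_univ_three] using habc)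
    exact ⟨this 0, this 1, this 2⟩
  · intro h g hg
    have := h (g 0) (g 1) (g 2) (by simpa [Fin.sum_univ_three] using hg)
    intro i
    fin_cases i
    exacts [this.1, this.2.1, this.2.2]

theorem LinearIndependent.triple_ext (h : LinearIndependent ℂ ![x, y, z]) {a b c a' b' c' : ℂ}
    (he : a • x + b • y + c • z = a' • x + b' • y + c' • z) : a = a' ∧ b = b' ∧ c = c' := by
  obtain ⟨h1, h2, h3⟩ := linearIndependent_triple_iff.1 h (a - a') (b - b') (c - c') (by
    rw [← sub_eq_zero] at he
    rw [← he]; module)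
  exact ⟨sub_eq_zero.1 h1, sub_eq_zero.1 h2, sub_eq_zero.1 h3⟩

theorem LinearIndependent.triple_of_det (h : LinearIndependent ℂ ![x, y, z]) {x' y' z' : V}
    (a₁ a₂ a₃ b₁ b₂ b₃ c₁ c₂ c₃ : ℂ) (hx : x' = a₁ • x + a₂ • y + a₃ • z)
    (hy : y' = b₁ • x + b₂ • y + b₃ • z) (hz : z' = c₁ • x + c₂ • y + c₃ • z)
    (hdet : a₁ * (b₂ * c₃ - b₃ * c₂) - a₂ * (b₁ * c₃ - b₃ * c₁) + a₃ * (b₁ * c₂ - b₂ * c₁) ≠ 0) :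
    LinearIndependent ℂ ![x', y', z'] := by
  rw [linearIndependent_triple_iff]
  intro s t u hs
  obtain ⟨h1, h2, h3⟩ := linearIndependent_triple_iff.1 h (s * a₁ + t * b₁ + u * c₁)
    (s * a₂ + t * b₂ + u * c₂) (s * a₃ + t * b₃ + u * c₃) (by
      rw [← hs, hx, hy, hz]; module)
  refine ⟨?_, ?_, ?_⟩ <;> refine (mul_eq_zero.1 ?_).resolve_right hdet
  · linear_combination (b₂ * c₃ - b₃ * c₂) * h1 - (b₁ * c₃ - b₃ * c₁) * h2
      + (b₁ * c₂ - b₂ * c₁) * h3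
  · linear_combination -(a₂ * c₃ - a₃ * c₂) * h1 + (a₁ * c₃ - a₃ * c₁) * h2
      - (a₁ * c₂ - a₂ * c₁) * h3
  · linear_combination (a₂ * b₃ - a₃ * b₂) * h1 - (a₁ * b₃ - a₃ * b₁) * h2
      + (a₁ * b₂ - a₂ * b₁) * h3

theorem LinearIndependent.triple_exists (h : LinearIndependent ℂ ![x, y, z])
    (hd : Module.finrank ℂ V = 3) (v : V) : ∃ a b c : ℂ, v = a • x + b • y + c • z := by
  have hs := h.span_eq_top_of_card_eq_finrank (by simp [hd])
  have hv : v ∈ Submodule.span ℂ (Set.range ![x, y, z]) := hs ▸ Submodule.mem_top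
  rw [Submodule.mem_span_range_iff_exists_fun] at hv
  obtain ⟨c, hc⟩ := hv
  exact ⟨c 0, c 1, c 2, by simpa [Fin.sum_univ_three] using hc.symm⟩

theorem exists_triple (hd : Module.finrank ℂ V = 3) (hx : x ≠ 0) :
    ∃ y z : V, LinearIndependent ℂ ![x, y, z] := by
  have h1 : LinearIndependent ℂ ![x] := .of_subsingleton (v := ![x]) 0 hx
  obtain ⟨y, h2⟩ := exists_linearIndependent_snoc_of_lt_finrank h1 (by omega)
  obtain ⟨z, h3⟩ := exists_linearIndependent_snoc_of_lt_finrank h2 (by omega)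
  have h : (Fin.snoc (Fin.snoc ![x] y) z : Fin 3 → V) = ![x, y, z] := by
    funext i
    fin_cases i <;> rfl
  exact ⟨y, z, h ▸ h3⟩

/-- A vector in the kernel of a nonzero linear form belongs to a basis adapted to that form. -/
theorem exists_triple_of_form (hd : Module.finrank ℂ V = 3) {φ : V →ₗ[ℂ] ℂ} (hφ : φ ≠ 0)
    (hx : x ≠ 0) (hφx : φ x = 0) :
    ∃ y z : V, LinearIndependent ℂ ![x, y, z] ∧ φ y = 0 ∧ φ z = 1 := by
  obtain ⟨y, z, h⟩ := exists_triple hd hx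
  by_cases hz : φ z = 0
  · have hy : φ y ≠ 0 := by
      intro hy
      apply hφ
      ext v
      obtain ⟨a, b, c, rfl⟩ := h.triple_exists hd v
      simp [hφx, hy, hz]
    refine ⟨z, (φ y)⁻¹ • y, h.triple_of_det 1 0 0 0 0 1 0 (φ y)⁻¹ 0 (by module) (by module)
      (by module) (by simpa using hy), hz, by simp [hy]⟩
  · refine ⟨y - (φ y / φ z) • z, (φ z)⁻¹ • z, h.triple_of_det 1 0 0 0 1 (-(φ y / φ z)) 0 0 (φ z)⁻¹
      (by module) (by module) (by module) (by simpa using hz), ?_, by simp [hz]⟩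
    simp [hz]

theorem exists_ne_zero_mem_ker (hd : Module.finrank ℂ V = 3) (φ : V →ₗ[ℂ] ℂ) :
    ∃ x : V, x ≠ 0 ∧ φ x = 0 := by
  have : FiniteDimensional ℂ V := FiniteDimensional.of_finrank_pos (by omega)
  have h : LinearMap.ker φ ≠ ⊥ := LinearMap.ker_ne_bot_of_finrank_lt (by simp [hd])
  obtain ⟨x, hx, hx0⟩ := Submodule.exists_mem_ne_zero_of_ne_bot h
  exact ⟨x, hx0, hx⟩

/-- A complex `2 × 2` matrix has an eigenvector. -/
theorem exists_eigenvector_two (a b c d : ℂ) : ∃ l s t : ℂ, (s ≠ 0 ∨ t ≠ 0) ∧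
    a * s + b * t = l * s ∧ c * s + d * t = l * t := by
  by_cases hb : b = 0
  · exact ⟨d, 0, 1, Or.inr one_ne_zero, by simp [hb], by simp⟩
  · obtain ⟨w, hw⟩ := IsAlgClosed.exists_eq_mul_self ((a - d) ^ 2 + 4 * b * c)
    refine ⟨(a + d + w) / 2, b, (a + d + w) / 2 - a, Or.inl hb, by ring, ?_⟩
    linear_combination (1 / 4 : ℂ) * hw

end Triples

section Classification

variable {g : Type u} [LieRing g] [LieAlgebra ℂ g]

/-- The structure constants of the algebra with label `m`, with respect to the basis `x, y, z` of
the even part `g`, where `χ` is the character by which `g` acts on the odd line spanned by `f`,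
and `c = [f, f]`. -/
def Matches (χ : g →ₗ[ℂ] ℂ) (c x y z : g) : ModuliPoint → Prop
  | .d1 => c = 0 ∧ χ x = 0 ∧ χ y = 0 ∧ χ z = 0 ∧ ⁅x, y⁆ = z ∧ ⁅x, z⁆ = y ∧ ⁅y, z⁆ = x
  | .d2 p q => c = (-8 : ℂ) • x ∧ χ x = 0 ∧ χ y = 0 ∧ χ z = p ∧
      ⁅x, y⁆ = 0 ∧ ⁅x, z⁆ = (-2 * p) • x ∧ ⁅y, z⁆ = x + q • y
  | .d3 => c = (-8 : ℂ) • x ∧ χ x = 0 ∧ χ y = 0 ∧ χ z = 1 ∧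
      ⁅x, y⁆ = 0 ∧ ⁅x, z⁆ = (-2 : ℂ) • x ∧ ⁅y, z⁆ = (-2 : ℂ) • y
  | .d4 => c = (-8 : ℂ) • x ∧ χ x = 0 ∧ χ y = 0 ∧ χ z = 0 ∧
      ⁅x, y⁆ = 0 ∧ ⁅x, z⁆ = 0 ∧ ⁅y, z⁆ = 0
  | .d5 => c = 0 ∧ χ x = 0 ∧ χ y = 0 ∧ χ z = 1 ∧ ⁅x, y⁆ = x ∧ ⁅x, z⁆ = 0 ∧ ⁅y, z⁆ = 0
  | .d6 p q r => c = 0 ∧ χ x = 0 ∧ χ y = 0 ∧ χ z = p ∧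
      ⁅x, y⁆ = 0 ∧ ⁅x, z⁆ = q • x ∧ ⁅y, z⁆ = x + r • y
  | .d7 p q => c = 0 ∧ χ x = 0 ∧ χ y = 0 ∧ χ z = p ∧
      ⁅x, y⁆ = 0 ∧ ⁅x, z⁆ = q • x ∧ ⁅y, z⁆ = q • y

theorem exists_matches_of_char_ne_zero (hd : Module.finrank ℂ g = 3) {χ : g →ₗ[ℂ] ℂ} {c : g}
    (hχ : ∀ x y : g, χ ⁅x, y⁆ = 0) (hχc : χ c = 0) (hc : ∀ x : g, ⁅x, c⁆ = (2 * χ x) • c)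
    (hc0 : c ≠ 0) (hχ0 : χ ≠ 0) :
    ∃ m x y z, LinearIndependent ℂ ![x, y, z] ∧ Matches χ c x y z m := by
  have hx0 : (-1 / 8 : ℂ) • c ≠ 0 := smul_ne_zero (by norm_num) hc0
  have hχx : χ ((-1 / 8 : ℂ) • c) = 0 := by simp [hχc]
  obtain ⟨x, hx⟩ : ∃ x, x = (-1 / 8 : ℂ) • c := ⟨_, rfl⟩
  rw [← hx] at hx0 hχx
  have hcx : c = (-8 : ℂ) • x := by rw [hx]; module
  have hxv : ∀ v : g, ⁅x, v⁆ = (-2 * χ v) • x := by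
    intro v
    rw [← lie_skew, hx, lie_smul, hc]; module
  obtain ⟨y, z, h, hy, hz⟩ := exists_triple_of_form hd hχ0 hx0 hχx
  have hxy : ⁅x, y⁆ = 0 := by rw [hxv, hy]; module
  have hxz : ⁅x, z⁆ = (-2 : ℂ) • x := by rw [hxv, hz]; module
  obtain ⟨a, b, d, hyz⟩ := h.triple_exists hd ⁅y, z⁆
  have hd0 : d = 0 := by
    have := hχ y z
    rw [hyz] at this
    simpa [hχx, hy, hz] using this
  subst hd0
  by_cases ha : a = 0
  · by_cases hb : b = -2
    · exact ⟨.d3, x, y, z, h, hcx, hχx, hy, hz, hxy, hxz, by rw [hyz, ha, hb]; module⟩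
    · have hb' : 2 + b ≠ 0 := fun h0 => hb (by linear_combination h0)
      refine ⟨.d2 1 b, x, y - (2 + b)⁻¹ • x, z,
        h.triple_of_det 1 0 0 (-(2 + b)⁻¹) 1 0 0 0 1 (by module) (by module) (by module) (by simp),
        hcx, hχx, by simp [hy, hχx], hz, by simp [hxy], by rw [hxz]; module, ?_⟩
      rw [sub_lie, smul_lie, hxz, hyz, ha]
      match_scalars <;> field_simp
      ring
  · refine ⟨.d2 1 b, x, a⁻¹ • y, z,
      h.triple_of_det 1 0 0 0 a⁻¹ 0 0 0 1 (by module) (by module) (by module) (by simpa using ha),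
      hcx, hχx, by simp [hy], hz, by simp [hxy], by rw [hxz]; module, ?_⟩
    rw [smul_lie, hyz]
    match_scalars <;> field_simp
    simp

theorem exists_matches_of_char_eq_zero (hd : Module.finrank ℂ g = 3) {χ : g →ₗ[ℂ] ℂ} {c : g}
    (hc : ∀ x : g, ⁅x, c⁆ = (2 * χ x) • c) (hc0 : c ≠ 0) (hχ0 : χ = 0) :
    ∃ m x y z, LinearIndependent ℂ ![x, y, z] ∧ Matches χ c x y z m := by
  have hx0 : (-1 / 8 : ℂ) • c ≠ 0 := smul_ne_zero (by norm_num) hc0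
  obtain ⟨x, hx⟩ : ∃ x, x = (-1 / 8 : ℂ) • c := ⟨_, rfl⟩
  rw [← hx] at hx0
  have hcx : c = (-8 : ℂ) • x := by rw [hx]; module
  have hχv : ∀ v, χ v = 0 := by simp [hχ0]
  have hxv : ∀ v : g, ⁅x, v⁆ = 0 := by
    intro v
    rw [← lie_skew, hx, lie_smul, hc, hχv]; module
  obtain ⟨y, z, h⟩ := exists_triple hd hx0
  obtain ⟨a, b, d, hyz⟩ := h.triple_exists hd ⁅y, z⁆
  have hzy : ⁅z, y⁆ = -⁅y, z⁆ := (lie_skew _ _).symm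
  by_cases hb : b = 0
  · by_cases hd0 : d = 0
    · subst hb hd0
      by_cases ha : a = 0
      · exact ⟨.d4, x, y, z, h, hcx, hχv _, hχv _, hχv _, hxv _, hxv _,
          by rw [hyz, ha]; module⟩
      · refine ⟨.d2 0 0, x, a⁻¹ • y, z, h.triple_of_det 1 0 0 0 a⁻¹ 0 0 0 1 (by module) (by module)
          (by module) (by simpa using ha), hcx, hχv _, hχv _, hχv _, hxv _,
          by rw [hxv]; module, ?_⟩
        rw [smul_lie, hyz]
        match_scalars <;> field_simp
        all_goals simp
    · refine ⟨.d2 0 (-d), x, ⁅y, z⁆ + d⁻¹ • x, y, h.triple_of_det 1 0 0 (a + d⁻¹) b d 0 1 0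
        (by module) (by rw [hyz]; module) (by module) (by simpa using hd0), hcx, hχv _, hχv _,
        hχv _, hxv _, by rw [hxv]; module, ?_⟩
      have : ⁅⁅y, z⁆, y⁆ = (-d) • ⁅y, z⁆ := by
        rw [hyz, hb]
        simp only [add_lie, smul_lie, hxv, lie_self, hzy, hyz, hb]
        module
      rw [add_lie, smul_lie, hxv, this]
      match_scalars <;> field_simp
      simp
  · refine ⟨.d2 0 b, x, ⁅y, z⁆ - b⁻¹ • x, z, h.triple_of_det 1 0 0 (a - b⁻¹) b d 0 0 1
      (by module) (by rw [hyz]; module) (by module) (by simpa using hb), hcx, hχv _, hχv _,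
      hχv _, hxv _, by rw [hxv]; module, ?_⟩
    have : ⁅⁅y, z⁆, z⁆ = b • ⁅y, z⁆ := by
      rw [hyz]
      simp only [add_lie, smul_lie, hxv, lie_self, hyz]
      module
    rw [sub_lie, smul_lie, hxv, this]
    match_scalars <;> field_simp
    simp

theorem linearIndependent_lie_of_perfect (hd : Module.finrank ℂ g = 3)
    (hp : ∀ φ : g →ₗ[ℂ] ℂ, (∀ x y : g, φ ⁅x, y⁆ = 0) → φ = 0) {x y z : g}
    (h : LinearIndependent ℂ ![x, y, z]) : LinearIndependent ℂ ![⁅x, y⁆, ⁅x, z⁆, ⁅y, z⁆] := by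
  have : FiniteDimensional ℂ g := FiniteDimensional.of_finrank_pos (by omega)
  apply linearIndependent_of_top_le_span_of_card_eq_finrank _ (by simp [hd])
  by_contra hlt
  obtain ⟨φ, hφ, hle⟩ := Submodule.exists_le_ker_of_lt_top _ (lt_top_iff_ne_top.2
    fun h => hlt h.ge)
  have hker : ∀ i, φ (![⁅x, y⁆, ⁅x, z⁆, ⁅y, z⁆] i) = 0 := fun i =>
    hle (Submodule.subset_span ⟨i, rfl⟩)
  have h1 : φ ⁅x, y⁆ = 0 := hker 0
  have h2 : φ ⁅x, z⁆ = 0 := hker 1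
  have h3 : φ ⁅y, z⁆ = 0 := hker 2
  apply hφ
  apply hp
  intro v w
  obtain ⟨a, b, c, rfl⟩ := h.triple_exists hd v
  obtain ⟨a', b', c', rfl⟩ := h.triple_exists hd w
  simp only [lie_add, add_lie, lie_smul, smul_lie, lie_self, ← lie_skew y x, ← lie_skew z x,
    ← lie_skew z y, map_add, map_smul, map_neg, h1, h2, h3]
  simp

theorem exists_lie_eq_self_of_perfect (hd : Module.finrank ℂ g = 3)
    (hp : ∀ φ : g →ₗ[ℂ] ℂ, (∀ x y : g, φ ⁅x, y⁆ = 0) → φ = 0) :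
    ∃ y u : g, u ≠ 0 ∧ ⁅y, u⁆ = u := by
  have : Nontrivial g := Module.nontrivial_of_finrank_pos (R := ℂ) (by omega)
  obtain ⟨h, hh⟩ := exists_ne (0 : g)
  obtain ⟨v, w, hi⟩ := exists_triple hd hh
  have hl := linearIndependent_lie_of_perfect hd hp hi
  obtain ⟨m₁, a, c, h1⟩ := hi.triple_exists hd ⁅h, v⁆
  obtain ⟨m₂, b, d, h2⟩ := hi.triple_exists hd ⁅h, w⁆
  obtain ⟨l, s, t, hst, e1, e2⟩ := exists_eigenvector_two a b c d
  have hu : ⁅h, s • v + t • w⁆ = l • (s • v + t • w) + (s * m₁ + t * m₂) • h := by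
    rw [lie_add, lie_smul, lie_smul, h1, h2]
    match_scalars
    · ring
    · linear_combination e1
    · linear_combination e2
  by_cases hl0 : l = 0
  · have hm : s * m₁ + t * m₂ ≠ 0 := by
      intro hm
      rw [hl0, hm] at hu
      have := linearIndependent_triple_iff.1 hl s t 0 (by
        rw [lie_add, lie_smul, lie_smul] at hu
        rw [hu]; module)
      simp [this] at hst
    refine ⟨-(s * m₁ + t * m₂)⁻¹ • (s • v + t • w), h, hh, ?_⟩
    rw [smul_lie, ← lie_skew, hu, hl0, zero_smul, zero_add, smul_neg, neg_smul, neg_neg, smul_smul,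
      inv_mul_cancel₀ hm, one_smul]
  · refine ⟨l⁻¹ • h, (s • v + t • w) + (l⁻¹ * (s * m₁ + t * m₂)) • h, ?_, ?_⟩
    · intro h0
      have := linearIndependent_triple_iff.1 hi (l⁻¹ * (s * m₁ + t * m₂)) s t (by
        rw [← h0]; module)
      simp [this] at hst
    · rw [smul_lie, lie_add, hu, lie_smul, lie_self]
      match_scalars <;> field_simp

theorem exists_matches_of_perfect (hd : Module.finrank ℂ g = 3) {χ : g →ₗ[ℂ] ℂ}
    (hχ : ∀ x y : g, χ ⁅x, y⁆ = 0)
    (hp : ∀ φ : g →ₗ[ℂ] ℂ, (∀ x y : g, φ ⁅x, y⁆ = 0) → φ = 0) :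
    ∃ m x y z, LinearIndependent ℂ ![x, y, z] ∧ Matches χ 0 x y z m := by
  have hχv : ∀ v, χ v = 0 := by simp [hp χ hχ]
  obtain ⟨y, u, hu, hyu⟩ := exists_lie_eq_self_of_perfect hd hp
  have hy : y ≠ 0 := by rintro rfl; simp at hyu; exact hu hyu.symm
  have hpair : LinearIndependent ℂ ![y, u] := by
    rw [LinearIndependent.pair_iff' hy]
    rintro a rfl
    rw [lie_smul, lie_self, smul_zero] at hyu
    exact hu hyu.symm
  obtain ⟨z, hi⟩ := exists_linearIndependent_snoc_of_lt_finrank hpair (by omega)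
  replace hi : LinearIndependent ℂ ![y, u, z] := by
    have h : (Fin.snoc ![y, u] z : Fin 3 → g) = ![y, u, z] := by
      funext i
      fin_cases i <;> rfl
    exact h ▸ hi
  have hl := linearIndependent_triple_iff.1 (linearIndependent_lie_of_perfect hd hp hi)
  obtain ⟨c, b, a, hyz⟩ := hi.triple_exists hd ⁅y, z⁆
  obtain ⟨k, e, d, huz⟩ := hi.triple_exists hd ⁅u, z⁆
  have hj := leibniz_lie y u z
  rw [hyu, hyz, huz] at hj
  simp only [lie_add, lie_smul, lie_self, hyu, hyz, huz, ← lie_skew u y] at hj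
  obtain ⟨j1, j2, j3⟩ := hi.triple_ext (a := d * c) (b := e + d * b) (c := d * a)
    (a' := k + a * k) (b' := e + a * e - c) (c' := d + a * d) (by
      rw [← sub_eq_zero] at hj ⊢
      rw [← hj]; module)
  have hd0 : d = 0 := by linear_combination -j3
  subst hd0
  have hk : k ≠ 0 := by
    intro hk
    have := hl e 0 (-1) (by rw [hyu, huz, hk]; module)
    simp at this
  have ha : a = -1 := by
    have : k * (1 + a) = 0 := by linear_combination -j1
    linear_combination (mul_eq_zero.1 this).resolve_left hk
  subst ha
  have he : e = -c := by linear_combination j2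
  subst he
  obtain ⟨z', hz'⟩ : ∃ z', z' = z - (b / 2) • u - c • y := ⟨_, rfl⟩
  have hi' : LinearIndependent ℂ ![y, u, z'] := hi.triple_of_det 1 0 0 0 1 0 (-c) (-(b / 2)) 1
    (by module) (by module) (by rw [hz']; module) (by simp)
  have hyz' : ⁅y, z'⁆ = -z' := by
    rw [hz']
    simp only [lie_sub, lie_smul, lie_self, hyu, hyz]
    module
  have huz' : ⁅u, z'⁆ = k • y := by
    rw [hz']
    simp only [lie_sub, lie_smul, lie_self, ← lie_skew u y, hyu, huz]
    module
  refine ⟨.d1, y, u - (1 / (2 * k)) • z', u + (1 / (2 * k)) • z',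
    hi'.triple_of_det 1 0 0 0 1 (-(1 / (2 * k))) 0 1 (1 / (2 * k)) (by module) (by module)
    (by module) ?_, rfl, hχv _, hχv _, hχv _, ?_, ?_, ?_⟩
  · field_simp
    norm_num [hk]
  · rw [lie_sub, lie_smul, hyu, hyz']; module
  · rw [lie_add, lie_smul, hyu, hyz']; module
  · simp only [lie_add, sub_lie, smul_lie, lie_smul, lie_self, ← lie_skew z' u, huz']
    match_scalars
    field_simp
    norm_num

end Classification

section Classification

variable {g : Type u} [LieRing g] [LieAlgebra ℂ g]

theorem exists_abelian_ideal (hd : Module.finrank ℂ g = 3) {φ : g →ₗ[ℂ] ℂ}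
    (hφ : ∀ x y : g, φ ⁅x, y⁆ = 0) (hφ0 : φ ≠ 0) :
    ∃ (x y z : g) (a b c d : ℂ), LinearIndependent ℂ ![x, y, z] ∧ ⁅x, y⁆ = 0 ∧
      ⁅x, z⁆ = a • x + b • y ∧ ⁅y, z⁆ = c • x + d • y := by
  obtain ⟨x, hx0, hx⟩ := exists_ne_zero_mem_ker hd φ
  obtain ⟨y, z, h, hy, hz⟩ := exists_triple_of_form hd hφ0 hx0 hx
  have key : ∀ v w : g, ∃ a b : ℂ, ⁅v, w⁆ = a • x + b • y := by
    intro v w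
    obtain ⟨a, b, c, he⟩ := h.triple_exists hd ⁅v, w⁆
    have := hφ v w
    rw [he] at this
    refine ⟨a, b, ?_⟩
    have hc : c = 0 := by simpa [hx, hy, hz] using this
    rw [he, hc]; module
  obtain ⟨α, β, hxy⟩ := key x y
  by_cases h0 : α = 0 ∧ β = 0
  · obtain ⟨a, b, hxz⟩ := key x z
    obtain ⟨c, d, hyz⟩ := key y z
    exact ⟨x, y, z, a, b, c, d, h, by rw [hxy, h0.1, h0.2]; module, hxz, hyz⟩
  · obtain ⟨w, v, hi, hw, hv, hwv⟩ : ∃ w v : g, LinearIndependent ℂ ![w, v, z] ∧ φ w = 0 ∧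
        φ v = 0 ∧ ⁅w, v⁆ = w := by
      by_cases hα : α = 0
      · have hβ : β ≠ 0 := fun hβ => h0 ⟨hα, hβ⟩
        refine ⟨⁅x, y⁆, -β⁻¹ • x, h.triple_of_det α β 0 (-β⁻¹) 0 0 0 0 1 (by rw [hxy]; module)
          (by module) (by module) (by simpa using hβ), hφ x y, by simp [hx], ?_⟩
        rw [lie_smul, hxy, hα]
        simp only [add_lie, smul_lie, lie_self, ← lie_skew y x, hxy, hα]
        match_scalars <;> field_simp
      · refine ⟨⁅x, y⁆, α⁻¹ • y, h.triple_of_det α β 0 0 α⁻¹ 0 0 0 1 (by rw [hxy]; module)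
          (by module) (by module) (by simpa using hα), hφ x y, by simp [hy], ?_⟩
        rw [lie_smul, hxy]
        simp only [add_lie, smul_lie, lie_self, hxy]
        match_scalars <;> field_simp
    have key' : ∀ s : g, ∃ a b : ℂ, ⁅s, z⁆ = a • w + b • v := by
      intro s
      obtain ⟨a, b, c, he⟩ := hi.triple_exists hd ⁅s, z⁆
      have := hφ s z
      rw [he] at this
      refine ⟨a, b, ?_⟩
      have hc : c = 0 := by simpa [hw, hv, hz] using this
      rw [he, hc]; module
    obtain ⟨a, b, hwz⟩ := key' w
    obtain ⟨a', b', hvz⟩ := key' v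
    have hj := lie_lie w v z
    rw [hwv, hwz, hvz] at hj
    simp only [lie_add, lie_smul, lie_self, hwv, ← lie_skew v w] at hj
    obtain ⟨j1, j2, -⟩ := hi.triple_ext (a := a) (b := b) (c := 0) (a' := a + b') (b' := 0)
      (c' := 0) (by
        rw [← sub_eq_zero] at hj ⊢
        rw [← hj]; module)
    have hb' : b' = 0 := by linear_combination -j1
    refine ⟨w, z + a' • w - a • v, v, 1, 0, 0, 0, hi.triple_of_det 1 0 0 a' (-a) 1 0 1 0 (by module)
      (by module) (by module) (by simp), ?_, by rw [hwv]; module, ?_⟩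
    · simp only [lie_add, lie_sub, lie_smul, lie_self, hwz, hwv, j2]
      module
    · simp only [add_lie, sub_lie, smul_lie, lie_self, ← lie_skew z v, hvz, hwv, hb']
      module

/-- Normal forms for a semidirect product of a line with an abelian plane `⟨x, y⟩` on which the
character vanishes. -/
theorem exists_matches_of_char_eq_zero_on_ideal {χ : g →ₗ[ℂ] ℂ} {x y z : g}
    (h : LinearIndependent ℂ ![x, y, z]) {a b c d : ℂ} (hxy : ⁅x, y⁆ = 0)
    (hxz : ⁅x, z⁆ = a • x + b • y) (hyz : ⁅y, z⁆ = c • x + d • y) (hx : χ x = 0) (hy : χ y = 0) :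
    ∃ m x y z, LinearIndependent ℂ ![x, y, z] ∧ Matches χ 0 x y z m := by
  obtain ⟨q, s, t, hst, e1, e2⟩ := exists_eigenvector_two a c b d
  obtain ⟨X, Y, k, r, hi, hXY, hXz, hYz, hX, hY⟩ : ∃ (X Y : g) (k r : ℂ),
      LinearIndependent ℂ ![X, Y, z] ∧ ⁅X, Y⁆ = 0 ∧ ⁅X, z⁆ = q • X ∧ ⁅Y, z⁆ = k • X + r • Y ∧
      χ X = 0 ∧ χ Y = 0 := by
    have hX : ⁅s • x + t • y, z⁆ = q • (s • x + t • y) := by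
      rw [add_lie, smul_lie, smul_lie, hxz, hyz]
      match_scalars
      · linear_combination e1
      · linear_combination e2
    by_cases hs : s = 0
    · have ht : t ≠ 0 := by simpa [hs] using hst
      refine ⟨s • x + t • y, x, b / t, a, h.triple_of_det s t 0 1 0 0 0 0 1 (by module)
        (by module) (by module) (by simpa using ht), ?_, hX, ?_, by simp [hx, hy], hx⟩
      · simp [← lie_skew y x, hxy]
      · rw [hxz, hs]
        match_scalars <;> field_simp
        all_goals simp
    · refine ⟨s • x + t • y, y, c / s, d - c / s * t, h.triple_of_det s t 0 0 1 0 0 0 1 (by module)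
        (by module) (by module) (by simpa using hs), ?_, hX, ?_, by simp [hx, hy], hy⟩
      · simp [hxy]
      · rw [hyz]
        match_scalars <;> field_simp
        all_goals ring
  by_cases hk : k = 0
  · by_cases hqr : q = r
    · exact ⟨.d7 (χ z) q, X, Y, z, hi, rfl, hX, hY, rfl, hXY, hXz,
        by rw [hYz, hk, hqr]; module⟩
    · have hqr' : q - r ≠ 0 := sub_ne_zero.2 hqr
      refine ⟨.d6 (χ z) q r, X, Y + (q - r)⁻¹ • X, z, hi.triple_of_det 1 0 0 (q - r)⁻¹ 1 0 0 0 1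
        (by module) (by module) (by module) (by simp), rfl, hX, by simp [hX, hY], rfl,
        by simp [hXY], hXz, ?_⟩
      rw [add_lie, smul_lie, hXz, hYz, hk]
      match_scalars <;> field_simp
      ring
  · refine ⟨.d6 (χ z) q r, k • X, Y, z, hi.triple_of_det k 0 0 0 1 0 0 0 1
      (by module) (by module) (by module) (by simpa using hk), rfl, by simp [hX], hY, rfl,
      by simp [hXY], by rw [smul_lie, hXz]; module, hYz⟩

/-- Normal forms for a semidirect product of a line with an abelian plane `⟨x, y⟩` on which the
character does not vanish. -/
theorem exists_matches_of_char_ne_zero_on_ideal {χ : g →ₗ[ℂ] ℂ} (hχ : ∀ x y : g, χ ⁅x, y⁆ = 0)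
    {x y z : g} (h : LinearIndependent ℂ ![x, y, z]) {a b c d : ℂ} (hxy : ⁅x, y⁆ = 0)
    (hxz : ⁅x, z⁆ = a • x + b • y) (hyz : ⁅y, z⁆ = c • x + d • y) (hy : χ y ≠ 0) :
    ∃ m x y z, LinearIndependent ℂ ![x, y, z] ∧ Matches χ 0 x y z m := by
  obtain ⟨X, Y, Z, α, β, hi, hX, hY, hZ, hXY, hZX, hZY⟩ : ∃ (X Y Z : g) (α β : ℂ),
      LinearIndependent ℂ ![X, Y, Z] ∧ χ X = 0 ∧ χ Y = 1 ∧ χ Z = 0 ∧ ⁅X, Y⁆ = 0 ∧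
      ⁅X, Z⁆ = α • X ∧ ⁅Y, Z⁆ = β • X := by
    have h1 : a * χ x + b * χ y = 0 := by simpa [hxz] using hχ x z
    have h2 : c * χ x + d * χ y = 0 := by simpa [hyz] using hχ y z
    have hb : b = -a * χ x / χ y := by field_simp; linear_combination h1
    have hd : d = -c * χ x / χ y := by field_simp; linear_combination h2
    refine ⟨x - (χ x / χ y) • y, (χ y)⁻¹ • y, z - (χ z / χ y) • y, a - χ x / χ y * c, (χ y)⁻¹ * c,
      h.triple_of_det 1 (-(χ x / χ y)) 0 0 (χ y)⁻¹ 0 0 (-(χ z / χ y)) 1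
      (by module) (by module) (by module) (by simpa using hy), by simp [hy], by simp [hy],
      by simp [hy], by simp [hxy], ?_, ?_⟩
    · simp only [sub_lie, lie_sub, smul_lie, lie_smul, lie_self, hxy, hxz, hyz]
      rw [hb, hd]
      match_scalars <;> field_simp
      all_goals ring
    · simp only [lie_sub, smul_lie, lie_smul, lie_self, hyz]
      rw [hd]
      match_scalars <;> field_simp
  have hYX : ⁅Y, X⁆ = 0 := by rw [← lie_skew, hXY, neg_zero]
  have hZX' : ⁅Z, X⁆ = -α • X := by rw [← lie_skew, hZX, neg_smul]
  have hZY' : ⁅Z, Y⁆ = -β • X := by rw [← lie_skew, hZY, neg_smul]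
  by_cases hα : α = 0
  · by_cases hβ : β = 0
    · exact ⟨.d7 1 0, X, Z, Y, hi.triple_of_det 1 0 0 0 0 1 0 1 0 (by module) (by module)
        (by module) (by simp), rfl, hX, hZ, hY, by rw [hZX, hα]; module, by rw [hXY]; module,
        by rw [hZY', hβ]; module⟩
    · exact ⟨.d6 1 0 0, -β • X, Z, Y, hi.triple_of_det (-β) 0 0 0 0 1 0 1 0 (by module) (by module)
        (by module) (by simpa using hβ), rfl, by simp [hX], hZ, hY,
        by rw [smul_lie, hZX, hα]; module, by rw [smul_lie, hXY]; module, by rw [hZY']; module⟩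
  · refine ⟨.d5, X, α⁻¹ • Z, Y - (β / α) • X, hi.triple_of_det 1 0 0 0 0 α⁻¹ (-(β / α)) 1 0
      (by module) (by module) (by module) (by simpa using hα), rfl, hX, by simp [hZ],
      by simp [hX, hY], ?_, by simp [hXY], ?_⟩
    · rw [lie_smul, hZX, smul_smul, inv_mul_cancel₀ hα, one_smul]
    · rw [smul_lie, lie_sub, lie_smul, hZY', hZX']
      match_scalars
      field_simp
      ring

theorem exists_matches (hd : Module.finrank ℂ g = 3) {χ : g →ₗ[ℂ] ℂ} {c : g}
    (hχ : ∀ x y : g, χ ⁅x, y⁆ = 0) (hχc : χ c = 0) (hc : ∀ x : g, ⁅x, c⁆ = (2 * χ x) • c) :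
    ∃ m x y z, LinearIndependent ℂ ![x, y, z] ∧ Matches χ c x y z m := by
  by_cases hc0 : c = 0
  · subst hc0
    by_cases hp : ∀ φ : g →ₗ[ℂ] ℂ, (∀ x y : g, φ ⁅x, y⁆ = 0) → φ = 0
    · exact exists_matches_of_perfect hd hχ hp
    · push Not at hp
      obtain ⟨φ, hφ, hφ0⟩ := hp
      obtain ⟨x, y, z, a, b, c, d, h, hxy, hxz, hyz⟩ := exists_abelian_ideal hd hφ hφ0
      by_cases hy : χ y = 0
      · by_cases hx : χ x = 0
        · exact exists_matches_of_char_eq_zero_on_ideal h hxy hxz hyz hx hy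
        · exact exists_matches_of_char_ne_zero_on_ideal hχ (x := y) (y := x) (z := z)
            (h.triple_of_det 0 1 0 1 0 0 0 0 1 (by module) (by module) (by module) (by simp))
            (by rw [← lie_skew, hxy, neg_zero]) (by rw [hyz, add_comm]) (by rw [hxz, add_comm]) hx
      · exact exists_matches_of_char_ne_zero_on_ideal hχ h hxy hxz hyz hy
  · by_cases hχ0 : χ = 0
    · exact exists_matches_of_char_eq_zero hd hc hc0 hχ0
    · exact exists_matches_of_char_ne_zero hd hχ hχc hc hc0 hχ0

end Classification

namespace LieSuperalgebra

section Even

variable {L : Type*} [AddCommGroup L] [Module ℂ L] (A : LieSuperalgebra L)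

/-- The even part of a Lie superalgebra is a Lie ring. -/
abbrev evenLieRing : LieRing (A.grade 0) where
  bracket x y := ⟨A.bracket x y, A.bracket_mem 0 0 x y x.2 y.2⟩
  add_lie x y z := Subtype.ext (by simp)
  lie_add x y z := Subtype.ext (by simp)
  lie_self x := Subtype.ext (by
    have h := A.skew 0 0 x x x.2 x.2
    have h2 : (2 : ℂ) • A.bracket x x = 0 := by
      rw [two_smul]
      exact eq_neg_iff_add_eq_zero.1 (by simpa [koszulSign] using h)
    simpa using h2)
  leibniz_lie x y z := Subtype.ext (by
    have h := A.jacobi 0 0 0 x y z x.2 y.2 z.2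
    simpa [koszulSign] using h)

/-- The even part of a Lie superalgebra is a Lie algebra. -/
abbrev evenLieAlgebra : letI := A.evenLieRing; LieAlgebra ℂ (A.grade 0) :=
  letI := A.evenLieRing
  { lie_smul := fun t x y => Subtype.ext (by
      change A.bracket x (t • (y : L)) = t • A.bracket x y
      simp) }

end Even

section Iso

variable {L M : Type*} [AddCommGroup L] [Module ℂ L] [AddCommGroup M] [Module ℂ M]
  {A : LieSuperalgebra L} {B : LieSuperalgebra M}

theorem exists_add_of_mem_grade (A : LieSuperalgebra L) (x : L) :
    ∃ x₀ ∈ A.grade 0, ∃ x₁ ∈ A.grade 1, x₀ + x₁ = x := by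
  have h : x ∈ A.grade 0 ⊔ A.grade 1 := by rw [A.isCompl.sup_eq_top]; trivial
  exact Submodule.mem_sup.1 h

theorem eq_zero_of_mem_grade (A : LieSuperalgebra L) {x : L} (h0 : x ∈ A.grade 0)
    (h1 : x ∈ A.grade 1) : x = 0 :=
  Submodule.disjoint_def.1 A.isCompl.disjoint x h0 h1

theorem IsHom.symm {e : L ≃ₗ[ℂ] M} (h : IsHom A B e.toLinearMap) :
    IsHom B A e.symm.toLinearMap := by
  refine ⟨fun i y hy => ?_, fun x y => ?_⟩
  · obtain ⟨x₀, h0, x₁, h1, hx⟩ := A.exists_add_of_mem_grade (e.symm y)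
    have h0' : e x₀ ∈ B.grade 0 := h.1 0 _ h0
    have h1' : e x₁ ∈ B.grade 1 := h.1 1 _ h1
    have he : e x₀ + e x₁ = y := by rw [← map_add, hx, e.apply_symm_apply]
    change e.symm y ∈ A.grade i
    rcases zmod_two_eq i with rfl | rfl
    · have : e x₁ = 0 := B.eq_zero_of_mem_grade
        (by rw [← sub_eq_of_eq_add' he.symm]; exact sub_mem hy h0') h1'
      rw [← hx, (map_eq_zero_iff e e.injective).1 this, add_zero]
      exact h0
    · have : e x₀ = 0 := B.eq_zero_of_mem_grade h0'
        (by rw [← sub_eq_of_eq_add he.symm]; exact sub_mem hy h1')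
      rw [← hx, (map_eq_zero_iff e e.injective).1 this, zero_add]
      exact h1
  · apply e.injective
    have := h.2 (e.symm x) (e.symm y)
    simpa using this.symm

theorem Isomorphic.symm (h : A.Isomorphic B) : B.Isomorphic A := by
  obtain ⟨e, he⟩ := h
  exact ⟨e.symm, he.symm⟩

end Iso

section Classification

variable {L : Type u} [AddCommGroup L] [Module ℂ L] {A : LieSuperalgebra L}

theorem HasBidim.finrank_eq {m n : ℕ} (h : A.HasBidim m n) : Module.finrank ℂ L = m + n := by
  obtain ⟨_, h0, h1⟩ := h
  rw [← h0, ← h1, Submodule.finrank_add_eq_of_isCompl A.isCompl]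

/-- The linear map from `ℂ⁴` that sends the standard basis to `f, x, y, z`. -/
noncomputable def ofQuadruple (f x y z : L) : (Fin 4 → ℂ) →ₗ[ℂ] L :=
  Fintype.linearCombination ℂ ![f, x, y, z]

theorem ofQuadruple_apply (f x y z : L) (a : Fin 4 → ℂ) :
    ofQuadruple f x y z a = a 0 • f + a 1 • x + a 2 • y + a 3 • z := by
  simp [ofQuadruple, Fintype.linearCombination_apply, Fin.sum_univ_four]

theorem isomorphic_of_quadruple (hA : A.HasBidim 3 1) {m : ModuliPoint} {f x y z : L}
    (hf : f ∈ A.grade 1) (hf0 : f ≠ 0) (hx : x ∈ A.grade 0) (hy : y ∈ A.grade 0)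
    (hz : z ∈ A.grade 0) (h : LinearIndependent ℂ ![x, y, z])
    (hbr : ∀ a b, ofQuadruple f x y z (m.algebra.bracket a b) =
      A.bracket (ofQuadruple f x y z a) (ofQuadruple f x y z b)) :
    A.Isomorphic m.algebra := by
  have := hA.1
  have hinj : Function.Injective (ofQuadruple f x y z) := by
    rw [← LinearMap.ker_eq_bot, LinearMap.ker_eq_bot']
    intro a ha
    rw [ofQuadruple_apply] at ha
    have h1 : a 0 • f ∈ A.grade 1 := Submodule.smul_mem _ _ hf
    have h0 : a 1 • x + a 2 • y + a 3 • z ∈ A.grade 0 :=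
      add_mem (add_mem (Submodule.smul_mem _ _ hx) (Submodule.smul_mem _ _ hy))
        (Submodule.smul_mem _ _ hz)
    have he : a 0 • f = -(a 1 • x + a 2 • y + a 3 • z) := by
      rw [← sub_eq_zero, ← ha]; module
    have hf' : a 0 • f = 0 := A.eq_zero_of_mem_grade (he ▸ neg_mem h0) h1
    have ha0 : a 0 = 0 := (smul_eq_zero.1 hf').resolve_right hf0
    obtain ⟨h1, h2, h3⟩ := linearIndependent_triple_iff.1 h (a 1) (a 2) (a 3) (by
      rw [← ha, hf', zero_add])
    funext i
    fin_cases i <;> assumption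
  refine Isomorphic.symm ⟨LinearMap.linearEquivOfInjective (ofQuadruple f x y z) hinj
    (by simp [hA.finrank_eq]), fun i a ha => ?_, fun a b => hbr a b⟩
  change ofQuadruple f x y z a ∈ A.grade i
  rw [ofQuadruple_apply]
  replace ha := (mem_gradeL i a).1 ha
  rcases zmod_two_eq i with rfl | rfl
  · rw [ha.1 (by decide), zero_smul, zero_add]
    exact add_mem (add_mem (Submodule.smul_mem _ _ hx) (Submodule.smul_mem _ _ hy))
        (Submodule.smul_mem _ _ hz)
  · obtain ⟨h1, h2, h3⟩ := ha.2 (by decide)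
    rw [h1, h2, h3, zero_smul, zero_smul, zero_smul, add_zero, add_zero, add_zero]
    exact Submodule.smul_mem _ _ hf

theorem exists_odd_basis (hA : A.HasBidim 3 1) :
    ∃ f ∈ A.grade 1, f ≠ 0 ∧ ∀ v ∈ A.grade 1, ∃ a : ℂ, v = a • f := by
  obtain ⟨f, hf0, hf⟩ := finrank_eq_one_iff'.1 hA.2.2
  refine ⟨f, f.2, fun h => hf0 (Subtype.ext h), fun v hv => ?_⟩
  obtain ⟨a, ha⟩ := hf ⟨v, hv⟩
  exact ⟨a, congrArg Subtype.val ha.symm⟩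

theorem exists_isomorphic (hA : A.HasBidim 3 1) : ∃ m : ModuliPoint, A.Isomorphic m.algebra := by
  let := A.evenLieRing
  let := A.evenLieAlgebra
  have hcoe : ∀ x y : A.grade 0, ((⁅x, y⁆ : A.grade 0) : L) = A.bracket x y := fun _ _ => rfl
  obtain ⟨f, hf, hf0, hspan⟩ := exists_odd_basis hA
  obtain ⟨ψ, hψ⟩ : ∃ ψ : L →ₗ[ℂ] ℂ, ψ f = 1 :=
    Module.Projective.exists_dual_eq_one ℂ hf0
  let χ : A.grade 0 →ₗ[ℂ] ℂ := ψ ∘ₗ A.bracket.flip f ∘ₗ (A.grade 0).subtype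
  have hχf : ∀ x : A.grade 0, A.bracket x f = χ x • f := by
    intro x
    obtain ⟨a, ha⟩ := hspan _ (A.bracket_mem 0 1 x f x.2 hf)
    have : χ x = ψ (A.bracket x f) := rfl
    rw [this, ha, map_smul, hψ, smul_eq_mul, mul_one]
  let c : A.grade 0 := ⟨A.bracket f f, A.bracket_mem 1 1 f f hf hf⟩
  have hff : A.bracket f f = c := rfl
  have hfx : ∀ x : A.grade 0, A.bracket f x = -(χ x • f) := by
    intro x
    rw [← hχf, A.skew 1 0 f x hf x.2]
    simp [koszulSign]
  have hχ : ∀ x y : A.grade 0, χ ⁅x, y⁆ = 0 := by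
    intro x y
    have h := A.jacobi 0 0 1 x y f x.2 y.2 hf
    rw [← hcoe, hχf, hχf, hχf, map_smul, map_smul, hχf, hχf] at h
    have h' : χ ⁅x, y⁆ • f = 0 := by
      rw [← sub_eq_zero] at h
      rw [← neg_eq_zero, ← h]
      simp only [koszulSign]
      simp
      module
    exact (smul_eq_zero.1 h').resolve_right hf0
  have hχc : χ c = 0 := by
    have h := A.jacobi 1 1 1 f f f hf hf hf
    rw [hff, hfx, hχf] at h
    have h' : (3 * χ c) • f = 0 := by
      rw [← sub_eq_zero] at h
      rw [← neg_eq_zero, ← h]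
      simp [koszulSign]
      module
    simpa [hf0] using h'
  have hc : ∀ x : A.grade 0, ⁅x, c⁆ = (2 * χ x) • c := by
    intro x
    apply Subtype.ext
    have h := A.jacobi 0 1 1 x f f x.2 hf hf
    rw [hff, hχf, map_smul, map_smul, LinearMap.smul_apply, hff] at h
    rw [hcoe, h]
    simp [koszulSign]
    module
  obtain ⟨m, x, y, z, hi, hm⟩ := exists_matches hA.2.1 hχ hχc hc
  refine ⟨m, isomorphic_of_quadruple hA hf hf0 x.2 y.2 z.2 ?_ ?_⟩
  · have := hi.map' (A.grade 0).subtype (Submodule.ker_subtype _)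
    have he : (A.grade 0).subtype ∘ ![x, y, z] = ![(x : L), (y : L), (z : L)] := by
      funext i
      fin_cases i <;> rfl
    exact he ▸ this
  · have hyx : A.bracket y x = -A.bracket x y := by
      rw [A.skew 0 0 y x y.2 x.2]; simp [koszulSign]
    have hzx : A.bracket z x = -A.bracket x z := by
      rw [A.skew 0 0 z x z.2 x.2]; simp [koszulSign]
    have hzy : A.bracket z y = -A.bracket y z := by
      rw [A.skew 0 0 z y z.2 y.2]; simp [koszulSign]
    have hself : ∀ v : A.grade 0, A.bracket v v = 0 := fun v => by
      rw [← hcoe, lie_self, Submodule.coe_zero]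
    intro a b
    change ofQuadruple _ _ _ _ (m.codifferential (paritySign a) b) = _
    cases m <;> obtain ⟨h1, h2, h3, h4, h5, h6, h7⟩ := hm <;>
    replace h5 := congrArg Subtype.val h5 <;>
    replace h6 := congrArg Subtype.val h6 <;>
    replace h7 := congrArg Subtype.val h7 <;>
    rw [hcoe] at h5 h6 h7 <;>
    replace h1 := congrArg Subtype.val h1 <;>
    rw [← hff] at h1 <;>
    simp only [ofQuadruple_apply, map_add, map_smul, LinearMap.add_apply, LinearMap.smul_apply,
      hfx, hχf, hyx, hzx, hzy, hself, h1, h2, h3, h4, h5, h6, h7, Submodule.coe_add,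
      Submodule.coe_smul, Submodule.coe_zero, ModuliPoint.codifferential_d1,
      ModuliPoint.codifferential_d2,
      ModuliPoint.codifferential_d3, ModuliPoint.codifferential_d4, ModuliPoint.codifferential_d5,
      ModuliPoint.codifferential_d6, ModuliPoint.codifferential_d7, Matrix.cons_val] <;>
    module

end Classification

end LieSuperalgebra

namespace LieSuperalgebra

section Solvable

variable {L M : Type*} [AddCommGroup L] [Module ℂ L] [AddCommGroup M] [Module ℂ M]
  {A : LieSuperalgebra L} {B : LieSuperalgebra M}

theorem IsHom.map_derivedSeries_le {f : L →ₗ[ℂ] M} (h : IsHom A B f) (n : ℕ) :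
    (A.derivedSeries n).map f ≤ B.derivedSeries n := by
  induction n with
  | zero => exact le_top
  | succ n ih =>
    rw [Submodule.map_le_iff_le_comap]
    change Submodule.map₂ A.bracket (A.derivedSeries n) (A.derivedSeries n) ≤ _
    rw [Submodule.map₂_le]
    intro x hx y hy
    change f (A.bracket x y) ∈ Submodule.map₂ B.bracket (B.derivedSeries n) (B.derivedSeries n)
    rw [h.2]
    exact Submodule.apply_mem_map₂ _ (ih (Submodule.mem_map_of_mem hx))
      (ih (Submodule.mem_map_of_mem hy))

theorem IsHom.isSolvable {f : L →ₗ[ℂ] M} (h : IsHom A B f) (hf : Function.Injective f)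
    (hB : B.IsSolvable) : A.IsSolvable := by
  obtain ⟨n, hn⟩ := hB
  refine ⟨n, eq_bot_iff.2 fun x hx => ?_⟩
  have hfx : f x ∈ B.derivedSeries n := h.map_derivedSeries_le n (Submodule.mem_map_of_mem hx)
  rw [hn, Submodule.mem_bot] at hfx
  exact (map_eq_zero_iff f hf).1 hfx

theorem Isomorphic.isSolvable (h : A.Isomorphic B) (hB : B.IsSolvable) : A.IsSolvable := by
  obtain ⟨e, he⟩ := h
  exact he.isSolvable e.injective hB

end Solvable

section Ideal

variable {L : Type u} [AddCommGroup L] [Module ℂ L]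

/-- A subspace that contains all brackets and the odd part, as a Lie superalgebra. -/
def restrict (A : LieSuperalgebra L) (N : Submodule ℂ L) (hN : ∀ x y, A.bracket x y ∈ N)
    (h1 : A.grade 1 ≤ N) : LieSuperalgebra N where
  grade i := (A.grade i).comap N.subtype
  isCompl := by
    constructor
    · rw [Submodule.disjoint_def]
      intro x h0 h1
      exact Subtype.ext (A.eq_zero_of_mem_grade h0 h1)
    · rw [codisjoint_iff, eq_top_iff]
      rintro ⟨x, hx⟩ -
      obtain ⟨x₀, hx0, x₁, hx1, rfl⟩ := A.exists_add_of_mem_grade x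
      have hx1' := h1 hx1
      have hx0' : x₀ ∈ N := by simpa using sub_mem hx hx1'
      exact Submodule.mem_sup.2 ⟨⟨x₀, hx0'⟩, hx0, ⟨x₁, hx1'⟩, hx1, rfl⟩
  bracket := LinearMap.mk₂ ℂ (fun x y => ⟨A.bracket x y, hN x y⟩)
    (fun x y z => Subtype.ext (by simp)) (fun t x y => Subtype.ext (by simp))
    (fun x y z => Subtype.ext (by simp)) (fun t x y => Subtype.ext (by simp))
  bracket_mem i j x y hx hy := A.bracket_mem i j x y hx hy
  skew i j x y hx hy := Subtype.ext (A.skew i j x y hx hy)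
  jacobi i j k x y z hx hy hz := Subtype.ext (A.jacobi i j k x y z hx hy hz)

variable {A : LieSuperalgebra L}

theorem isHom_subtype_restrict (N : Submodule ℂ L) (hN : ∀ x y, A.bracket x y ∈ N)
    (h1 : A.grade 1 ≤ N) : IsHom (A.restrict N hN h1) A N.subtype :=
  ⟨fun _ _ hx => hx, fun _ _ => rfl⟩

theorem exists_isExtension_of_form (hA : A.HasBidim 3 1) (hs : A.IsSolvable) {φ : L →ₗ[ℂ] ℂ}
    (hφ : φ ≠ 0) (hN : ∀ x y, φ (A.bracket x y) = 0) (h1 : ∀ x ∈ A.grade 1, φ x = 0) :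
    ∃ (M : Type u) (_ : AddCommGroup M) (_ : Module ℂ M) (B : LieSuperalgebra M),
      B.HasBidim 2 1 ∧ B.IsSolvable ∧ A.IsExtension (trivialAlgebra 1 0) B := by
  have := hA.1
  have hι := isHom_subtype_restrict (A := A) (LinearMap.ker φ) hN h1
  refine ⟨LinearMap.ker φ, inferInstance, inferInstance, A.restrict (LinearMap.ker φ) hN h1,
    ⟨inferInstance, ?_, ?_⟩, hι.isSolvable Subtype.val_injective hs, (LinearMap.ker φ).subtype,
    LinearMap.inl ℂ (Fin 1 → ℂ) (Fin 0 → ℂ) ∘ₗ LinearMap.pi (fun _ => φ), hι, ⟨?_, ?_⟩,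
    Subtype.val_injective, ?_, ?_⟩
  · have e1 := Submodule.finrank_add_eq_of_isCompl (A.restrict (LinearMap.ker φ) hN h1).isCompl
    have e2 : Module.finrank ℂ ((A.restrict (LinearMap.ker φ) hN h1).grade 1) = 1 :=
      (Submodule.comapSubtypeEquivOfLe h1).finrank_eq.trans hA.2.2
    have e3 := Module.Dual.finrank_ker_add_one_of_ne_zero hφ
    have e4 := hA.finrank_eq
    omega
  · exact (Submodule.comapSubtypeEquivOfLe h1).finrank_eq.trans hA.2.2
  · intro i x hx
    rcases zmod_two_eq i with rfl | rfl
    · change _ ∈ LinearMap.ker (LinearMap.snd ℂ (Fin 1 → ℂ) (Fin 0 → ℂ))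
      simp
    · change _ ∈ LinearMap.ker (LinearMap.fst ℂ (Fin 1 → ℂ) (Fin 0 → ℂ))
      rw [LinearMap.mem_ker]
      funext j
      exact h1 x hx
  · intro x y
    refine Prod.ext (funext fun j => ?_) (Subsingleton.elim _ _)
    exact hN x y
  · intro x
    constructor
    · intro h
      exact ⟨⟨x, congrFun (congrArg Prod.fst h) 0⟩, rfl⟩
    · rintro ⟨y, rfl⟩
      refine Prod.ext (funext fun j => ?_) (Subsingleton.elim _ _)
      exact y.2
  · rintro ⟨a, b⟩
    obtain ⟨x, hx⟩ := LinearMap.surjective hφ (a 0)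
    refine ⟨x, Prod.ext (funext fun j => ?_) (Subsingleton.elim _ _)⟩
    rw [Subsingleton.elim j 0]
    exact hx

end Ideal

end LieSuperalgebra

namespace ModuliPoint

open LieSuperalgebra

theorem algebra_bracket (m : ModuliPoint) (x y : Fin 4 → ℂ) :
    m.algebra.bracket x y = m.codifferential (paritySign x) y := rfl

theorem hasBidim_algebra (m : ModuliPoint) : m.algebra.HasBidim 3 1 := by
  have h1 : Module.finrank ℂ (m.algebra.grade 1) = 1 := by
    refine finrank_eq_one_iff'.2 ⟨⟨Pi.single 0 1, ?_⟩, ?_, ?_⟩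
    · exact (mem_gradeL _ _).2 ⟨by simp, by simp⟩
    · intro h
      have := congrFun (congrArg Subtype.val h) 0
      simp at this
    · rintro ⟨x, hx⟩
      obtain ⟨h1, h2, h3⟩ := ((mem_gradeL 1 x).1 hx).2 (by decide)
      refine ⟨x 0, Subtype.ext (funext fun i => ?_)⟩
      fin_cases i <;> simp [h1, h2, h3]
  refine ⟨inferInstance, ?_, h1⟩
  have := Submodule.finrank_add_eq_of_isCompl m.algebra.isCompl
  rw [h1, Module.finrank_fin_fun] at this
  omega

theorem algebra_bracket_three {m : ModuliPoint} (hm : m ≠ d1) (x y : Fin 4 → ℂ) :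
    m.algebra.bracket x y 3 = 0 := by
  rw [algebra_bracket]
  cases m
  · exact absurd rfl hm
  · rw [codifferential_d2]; rfl
  · rw [codifferential_d3]; rfl
  · rw [codifferential_d4]; rfl
  · rw [codifferential_d5]; rfl
  · rw [codifferential_d6]; rfl
  · rw [codifferential_d7]; rfl

theorem isSolvable_algebra {m : ModuliPoint} (hm : m ≠ d1) : m.algebra.IsSolvable := by
  have h1 : ∀ x ∈ m.algebra.derivedSeries 1, x 3 = 0 := by
    change Submodule.map₂ _ _ _ ≤ LinearMap.ker (LinearMap.proj (R := ℂ) (φ := fun _ => ℂ) 3)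
    rw [Submodule.map₂_le]
    intro x _ y _
    exact algebra_bracket_three hm x y
  have h2 : ∀ x ∈ m.algebra.derivedSeries 2, x 0 = 0 ∧ x 2 = 0 ∧ x 3 = 0 := by
    change Submodule.map₂ _ _ _ ≤ (⟨⟨⟨{x | x 0 = 0 ∧ x 2 = 0 ∧ x 3 = 0},
      fun {x y} hx hy => by simp [hx.1, hx.2.1, hx.2.2, hy.1, hy.2.1, hy.2.2]⟩, by simp⟩,
      fun c x hx => by simp [hx.1, hx.2.1, hx.2.2]⟩ : Submodule ℂ (Fin 4 → ℂ))
    rw [Submodule.map₂_le]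
    intro x hx y hy
    have hx3 := h1 x hx
    have hy3 := h1 y hy
    change _ ∧ _ ∧ _
    rw [algebra_bracket]
    cases m <;> simp_all [codifferential_d2, codifferential_d3, codifferential_d4,
      codifferential_d5, codifferential_d6, codifferential_d7]
  refine ⟨3, le_bot_iff.1 ?_⟩
  change Submodule.map₂ _ _ _ ≤ _
  rw [Submodule.map₂_le]
  intro x hx y hy
  obtain ⟨x0, x2, x3⟩ := h2 x hx
  obtain ⟨y0, y2, y3⟩ := h2 y hy
  rw [Submodule.mem_bot, algebra_bracket]
  cases m <;> simp_all [codifferential_d2, codifferential_d3, codifferential_d4,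
      codifferential_d5, codifferential_d6, codifferential_d7]

theorem not_isSolvable_d1 : ¬ d1.algebra.IsSolvable := by
  have key : ∀ n, ∀ a b c : ℂ, ![0, a, b, c] ∈ d1.algebra.derivedSeries n := by
    intro n
    induction n with
    | zero => intros; trivial
    | succ n ih =>
      intro a b c
      have h := fun x y hx hy => Submodule.apply_mem_map₂ d1.algebra.bracket
        (m := x) (n := y) (p := d1.algebra.derivedSeries n) (q := d1.algebra.derivedSeries n) hx hy
      have hc := h _ _ (ih c 0 0) (ih 0 1 0)
      have hb := h _ _ (ih b 0 0) (ih 0 0 1)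
      have ha := h _ _ (ih 0 a 0) (ih 0 0 1)
      have := add_mem (add_mem ha hb) hc
      rw [algebra_bracket, algebra_bracket, algebra_bracket, codifferential_d1, codifferential_d1,
        codifferential_d1] at this
      change _ ∈ Submodule.map₂ _ _ _
      simpa using this
  rintro ⟨n, hn⟩
  have := key n 1 0 0
  rw [hn, Submodule.mem_bot] at this
  simpa using congrFun this 1

/-- The projection of `d1` onto `sl(2, ℂ)`. -/
noncomputable def toSl2 : (Fin 4 → ℂ) →ₗ[ℂ] LieAlgebra.SpecialLinear.sl (Fin 2) ℂ where
  toFun x := ⟨!![x 1 / 2, x 2 + x 3; (x 3 - x 2) / 4, -(x 1 / 2)], by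
    change _ ∈ LinearMap.ker (Matrix.traceLinearMap (Fin 2) ℂ ℂ)
    simp [Matrix.trace, Fin.sum_univ_two]⟩
  map_add' x y := Subtype.ext (by
    change _ = _ + _
    ext i j
    fin_cases i <;> fin_cases j <;> simp <;> ring)
  map_smul' t x := Subtype.ext (by
    change _ = t • _
    ext i j
    fin_cases i <;> fin_cases j <;> simp <;> ring)

theorem coe_toSl2 (x : Fin 4 → ℂ) :
    (toSl2 x).1 = !![x 1 / 2, x 2 + x 3; (x 3 - x 2) / 4, -(x 1 / 2)] := rfl

theorem toSl2_bracket (x y : Fin 4 → ℂ) :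
    toSl2 (d1.algebra.bracket x y) = ⁅toSl2 x, toSl2 y⁆ := by
  apply Subtype.ext
  rw [LieAlgebra.SpecialLinear.sl_bracket, coe_toSl2, coe_toSl2, coe_toSl2, algebra_bracket,
    codifferential_d1, Matrix.mul_fin_two, Matrix.mul_fin_two]
  ext i j
  fin_cases i <;> fin_cases j <;> simp <;> ring

theorem toSl2_eq_zero_iff (x : Fin 4 → ℂ) : toSl2 x = 0 ↔ x 1 = 0 ∧ x 2 = 0 ∧ x 3 = 0 := by
  constructor
  · intro h
    have h' := congrArg Subtype.val h
    rw [coe_toSl2] at h'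
    have e1 : x 1 / 2 = 0 := congrFun (congrFun h' 0) 0
    have e2 : x 2 + x 3 = 0 := congrFun (congrFun h' 0) 1
    have e3 : (x 3 - x 2) / 4 = 0 := congrFun (congrFun h' 1) 0
    refine ⟨by linear_combination 2 * e1, ?_, ?_⟩
    · linear_combination (1 / 2 : ℂ) * e2 - 2 * e3
    · linear_combination (1 / 2 : ℂ) * e2 + 2 * e3
  · rintro ⟨h1, h2, h3⟩
    apply Subtype.ext
    rw [coe_toSl2, h1, h2, h3]
    ext i j
    fin_cases i <;> fin_cases j <;> simp

theorem toSl2_surjective : Function.Surjective toSl2 := by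
  rintro ⟨X, hX⟩
  have ht : X 0 0 + X 1 1 = 0 := by
    have : X ∈ LinearMap.ker (Matrix.traceLinearMap (Fin 2) ℂ ℂ) := hX
    simpa [Matrix.trace, Fin.sum_univ_two] using this
  refine ⟨![0, 2 * X 0 0, X 0 1 / 2 - 2 * X 1 0, X 0 1 / 2 + 2 * X 1 0], Subtype.ext ?_⟩
  rw [coe_toSl2]
  ext i j
  fin_cases i <;> fin_cases j <;> simp
  · ring
  · linear_combination -ht

theorem isExtension_d1 : d1.algebra.IsExtension sl2 (trivialAlgebra 0 1) := by
  refine ⟨LinearMap.single ℂ (fun _ => ℂ) 0 ∘ₗ LinearMap.proj 0 ∘ₗ LinearMap.snd ℂ _ _, toSl2,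
    ⟨?_, ?_⟩, ⟨?_, toSl2_bracket⟩, ?_, ?_, toSl2_surjective⟩
  · intro i x hx
    refine (mem_gradeL _ _).2 ⟨fun hi => ?_, fun _ => by simp⟩
    rcases zmod_two_eq i with rfl | rfl
    · replace hx : x.2 = 0 := hx
      simp [hx]
    · exact absurd rfl hi
  · intro x y
    rw [algebra_bracket, codifferential_d1]
    ext i
    fin_cases i <;> simp [trivialAlgebra]
  · intro i x hx
    rcases zmod_two_eq i with rfl | rfl
    · trivial
    · exact (toSl2_eq_zero_iff x).2 (((mem_gradeL 1 x).1 hx).2 (by decide))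
  · rintro ⟨a, b⟩ ⟨a', b'⟩ h
    refine Prod.ext (Subsingleton.elim _ _) (funext fun j => ?_)
    rw [Subsingleton.elim j 0]
    simpa using congrFun h 0
  · intro x
    rw [toSl2_eq_zero_iff]
    constructor
    · rintro ⟨h1, h2, h3⟩
      refine ⟨(0, fun _ => x 0), ?_⟩
      ext i
      fin_cases i <;> simp [h1, h2, h3]
    · rintro ⟨y, rfl⟩
      simp

end ModuliPoint

namespace LieSuperalgebra

theorem isSolvable_and_exists_isExtension {L : Type u} [AddCommGroup L] [Module ℂ L]
    {A : LieSuperalgebra L} (hA : A.HasBidim 3 1) (h : ¬ A.Isomorphic ModuliPoint.d1.algebra) :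
    A.IsSolvable ∧ ∃ (M : Type u) (_ : AddCommGroup M) (_ : Module ℂ M) (B : LieSuperalgebra M),
      B.HasBidim 2 1 ∧ B.IsSolvable ∧ A.IsExtension (trivialAlgebra 1 0) B := by
  obtain ⟨m, hm⟩ := exists_isomorphic hA
  have hm1 : m ≠ .d1 := by
    rintro rfl
    exact h hm
  have hs := hm.isSolvable (ModuliPoint.isSolvable_algebra hm1)
  obtain ⟨e, he⟩ := hm
  refine ⟨hs, exists_isExtension_of_form hA hs (φ := LinearMap.proj 3 ∘ₗ e.toLinearMap) ?_ ?_ ?_⟩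
  · intro h0
    have := LinearMap.congr_fun h0 (e.symm (Pi.single 3 1))
    simp at this
  · intro x y
    change e.toLinearMap (A.bracket x y) 3 = 0
    rw [he.2]
    exact ModuliPoint.algebra_bracket_three hm1 _ _
  · intro x hx
    exact (((mem_gradeL 1 _).1 (he.1 1 x hx)).2 (by decide)).2.2

end LieSuperalgebra

namespace ModuliPoint

open LieSuperalgebra

theorem linearIndependent_even :
    LinearIndependent ℂ ![(![0, 1, 0, 0] : Fin 4 → ℂ), ![0, 0, 1, 0], ![0, 0, 0, 1]] := by
  rw [linearIndependent_triple_iff]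
  intro a b c h
  have h1 := congrFun h 1
  have h2 := congrFun h 2
  have h3 := congrFun h 3
  simp at h1 h2 h3
  exact ⟨h1, h2, h3⟩

theorem single_mem_odd (m : ModuliPoint) : (![1, 0, 0, 0] : Fin 4 → ℂ) ∈ m.algebra.grade 1 :=
  (mem_gradeL _ _).2 ⟨by simp, by simp⟩

theorem vec_mem_even (m : ModuliPoint) (a b c : ℂ) :
    (![0, a, b, c] : Fin 4 → ℂ) ∈ m.algebra.grade 0 :=
  (mem_gradeL _ _).2 ⟨by simp, by simp⟩

theorem isomorphic_of_vectors {m m' : ModuliPoint} (a₁ a₂ a₃ b₁ b₂ b₃ c₁ c₂ c₃ : ℂ)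
    (hdet : a₁ * (b₂ * c₃ - b₃ * c₂) - a₂ * (b₁ * c₃ - b₃ * c₁) + a₃ * (b₁ * c₂ - b₂ * c₁) ≠ 0)
    (hbr : ∀ a b, ofQuadruple (![1, 0, 0, 0] : Fin 4 → ℂ) ![0, a₁, a₂, a₃] ![0, b₁, b₂, b₃]
      ![0, c₁, c₂, c₃] (m'.algebra.bracket a b) = m.algebra.bracket
      (ofQuadruple (![1, 0, 0, 0] : Fin 4 → ℂ) ![0, a₁, a₂, a₃] ![0, b₁, b₂, b₃] ![0, c₁, c₂, c₃] a)
      (ofQuadruple (![1, 0, 0, 0] : Fin 4 → ℂ) ![0, a₁, a₂, a₃] ![0, b₁, b₂, b₃] ![0, c₁, c₂, c₃] b)) :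
    m.algebra.Isomorphic m'.algebra := by
  refine isomorphic_of_quadruple (hasBidim_algebra m) (single_mem_odd m) ?_ (vec_mem_even m _ _ _)
    (vec_mem_even m _ _ _) (vec_mem_even m _ _ _) ?_ hbr
  · intro h
    simpa using congrFun h 0
  · refine linearIndependent_even.triple_of_det a₁ a₂ a₃ b₁ b₂ b₃ c₁ c₂ c₃ ?_ ?_ ?_ hdet <;> simp

theorem ofQuadruple_vec (a₁ a₂ a₃ b₁ b₂ b₃ c₁ c₂ c₃ : ℂ) (v : Fin 4 → ℂ) :
    ofQuadruple (![1, 0, 0, 0] : Fin 4 → ℂ) ![0, a₁, a₂, a₃] ![0, b₁, b₂, b₃] ![0, c₁, c₂, c₃] v =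
      ![v 0, v 1 * a₁ + v 2 * b₁ + v 3 * c₁, v 1 * a₂ + v 2 * b₂ + v 3 * c₂,
        v 1 * a₃ + v 2 * b₃ + v 3 * c₃] := by
  rw [ofQuadruple_apply]
  ext i
  fin_cases i <;> simp

theorem isomorphic_d2 (p q t : ℂ) (ht : t ≠ 0) :
    (d2 p q).algebra.Isomorphic (d2 (t * p) (t * q)).algebra := by
  refine isomorphic_of_vectors 1 0 0 0 t⁻¹ 0 0 0 t (by simp [ht]) fun a b => ?_
  simp only [ofQuadruple_vec, algebra_bracket, codifferential_d2]
  ext i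
  fin_cases i <;> simp only [Fin.reduceFinMk, Fin.zero_eta, Fin.mk_one, Matrix.cons_val] <;>
    field_simp <;> ring

theorem isomorphic_d6 (p q r t : ℂ) (ht : t ≠ 0) :
    (d6 p q r).algebra.Isomorphic (d6 (t * p) (t * q) (t * r)).algebra := by
  refine isomorphic_of_vectors 1 0 0 0 t⁻¹ 0 0 0 t (by simp [ht]) fun a b => ?_
  simp only [ofQuadruple_vec, algebra_bracket, codifferential_d6]
  ext i
  fin_cases i <;> simp only [Fin.reduceFinMk, Fin.zero_eta, Fin.mk_one, Matrix.cons_val] <;>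
    field_simp <;> ring

theorem isomorphic_d6_swap (p q r t : ℂ) (ht : t ≠ 0) :
    (d6 p q r).algebra.Isomorphic (d6 (t * p) (t * r) (t * q)).algebra := by
  refine isomorphic_of_vectors t (t * (r - q)) 0 0 1 0 0 0 t (by simp [ht]) fun a b => ?_
  simp only [ofQuadruple_vec, algebra_bracket, codifferential_d6]
  ext i
  fin_cases i <;> simp only [Fin.reduceFinMk, Fin.zero_eta, Fin.mk_one, Matrix.cons_val] <;> ring

theorem isomorphic_d7 (p q t : ℂ) (ht : t ≠ 0) :
    (d7 p q).algebra.Isomorphic (d7 (t * p) (t * q)).algebra := by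
  refine isomorphic_of_vectors 1 0 0 0 1 0 0 0 t (by simp [ht]) fun a b => ?_
  simp only [ofQuadruple_vec, algebra_bracket, codifferential_d7]
  ext i
  fin_cases i <;> simp only [Fin.reduceFinMk, Fin.zero_eta, Fin.mk_one, Matrix.cons_val] <;> ring

theorem isomorphic_refl (m : ModuliPoint) : m.algebra.Isomorphic m.algebra :=
  ⟨LinearEquiv.refl ℂ _, fun _ _ hx => hx, fun _ _ => rfl⟩

theorem Same.isomorphic {m m' : ModuliPoint} (h : m.Same m') :
    m.algebra.Isomorphic m'.algebra := by
  cases m <;> cases m' <;> simp only [Same] at h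
  case d2.d2 => obtain ⟨t, ht, rfl, rfl⟩ := h; exact isomorphic_d2 _ _ t ht
  case d6.d6 =>
    obtain ⟨t, ht, rfl, ⟨rfl, rfl⟩ | ⟨rfl, rfl⟩⟩ := h
    · exact isomorphic_d6 _ _ _ t ht
    · exact isomorphic_d6_swap _ _ _ t ht
  case d7.d7 => obtain ⟨t, ht, rfl, rfl⟩ := h; exact isomorphic_d7 _ _ t ht
  all_goals exact isomorphic_refl _

/-- Any two odd elements have bracket zero. -/
def OddAbelian {L : Type*} [AddCommGroup L] [Module ℂ L] (A : LieSuperalgebra L) : Prop :=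
  ∀ x ∈ A.grade 1, ∀ y ∈ A.grade 1, A.bracket x y = 0

/-- Any two even elements span a subalgebra. -/
def EvenPlanar {L : Type*} [AddCommGroup L] [Module ℂ L] (A : LieSuperalgebra L) : Prop :=
  ∀ x ∈ A.grade 0, ∀ y ∈ A.grade 0, ∃ a b : ℂ, A.bracket x y = a • x + b • y

section Invariants

variable {L M : Type*} [AddCommGroup L] [Module ℂ L] [AddCommGroup M] [Module ℂ M]
  {A : LieSuperalgebra L} {B : LieSuperalgebra M}

theorem OddAbelian.of_isomorphic (hA : OddAbelian A) (h : B.Isomorphic A) : OddAbelian B := by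
  obtain ⟨e, he⟩ := h
  intro x hx y hy
  apply e.injective
  rw [map_zero]
  exact (he.2 x y).trans (hA _ (he.1 1 x hx) _ (he.1 1 y hy))

theorem EvenPlanar.of_isomorphic (hA : EvenPlanar A) (h : B.Isomorphic A) : EvenPlanar B := by
  obtain ⟨e, he⟩ := h
  intro x hx y hy
  obtain ⟨a, b, hab⟩ := hA _ (he.1 0 x hx) _ (he.1 0 y hy)
  refine ⟨a, b, e.injective ?_⟩
  rw [map_add, map_smul, map_smul]
  exact (he.2 x y).trans hab

end Invariants

theorem oddAbelian_iff (m : ModuliPoint) : OddAbelian m.algebra ↔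
    match m with
    | d2 _ _ | d3 | d4 => False
    | _ => True := by
  have h0 : ∀ x ∈ m.algebra.grade 1, x 1 = 0 ∧ x 2 = 0 ∧ x 3 = 0 := fun x hx =>
    ((mem_gradeL 1 x).1 hx).2 (by decide)
  have h1 := single_mem_odd m
  cases m
  case d2 p q =>
    simp only [iff_false]
    intro h
    have := congrFun (h _ h1 _ h1) 1
    rw [algebra_bracket, codifferential_d2] at this
    simp at this
  case d3 =>
    simp only [iff_false]
    intro h
    have := congrFun (h _ h1 _ h1) 1
    rw [algebra_bracket, codifferential_d3] at this
    simp at this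
  case d4 =>
    simp only [iff_false]
    intro h
    have := congrFun (h _ h1 _ h1) 1
    rw [algebra_bracket, codifferential_d4] at this
    simp at this
  all_goals
    simp only [iff_true]
    intro x hx y hy
    obtain ⟨x1, x2, x3⟩ := h0 x hx
    obtain ⟨y1, y2, y3⟩ := h0 y hy
    rw [algebra_bracket]
    simp [codifferential_d1, codifferential_d5, codifferential_d6, codifferential_d7, x1, x2, x3,
      y1, y2, y3]

theorem evenPlanar_iff (m : ModuliPoint) : EvenPlanar m.algebra ↔
    match m with
    | d3 | d4 | d7 _ _ => True
    | _ => False := by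
  have h0 : ∀ x ∈ m.algebra.grade 0, x 0 = 0 := fun x hx =>
    ((mem_gradeL 0 x).1 hx).1 (by decide)
  have h1 := vec_mem_even m
  cases m
  case d1 =>
    simp only [iff_false]
    intro h
    obtain ⟨a, b, hab⟩ := h _ (h1 1 0 0) _ (h1 0 1 0)
    have := congrFun hab 3
    rw [algebra_bracket, codifferential_d1] at this
    simp at this
  case d2 p q =>
    simp only [iff_false]
    intro h
    obtain ⟨a, b, hab⟩ := h _ (h1 0 1 0) _ (h1 0 0 1)
    have := congrFun hab 1
    rw [algebra_bracket, codifferential_d2] at this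
    simp at this
  case d5 =>
    simp only [iff_false]
    intro h
    obtain ⟨a, b, hab⟩ := h _ (h1 1 0 1) _ (h1 0 1 0)
    have e1 := congrFun hab 1
    have e3 := congrFun hab 3
    rw [algebra_bracket, codifferential_d5] at e1 e3
    simp at e1 e3
    rw [← e1] at e3
    simp at e3
  case d6 p q r =>
    simp only [iff_false]
    intro h
    obtain ⟨a, b, hab⟩ := h _ (h1 0 1 0) _ (h1 0 0 1)
    have := congrFun hab 1
    rw [algebra_bracket, codifferential_d6] at this
    simp at this
  case d3 =>
    simp only [iff_true]
    intro x hx y hy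
    refine ⟨-2 * y 3, 2 * x 3, ?_⟩
    rw [algebra_bracket, codifferential_d3]
    ext i
    fin_cases i <;> simp [h0 x hx, h0 y hy] <;> ring
  case d4 =>
    simp only [iff_true]
    intro x hx y hy
    refine ⟨0, 0, ?_⟩
    rw [algebra_bracket, codifferential_d4]
    ext i
    fin_cases i <;> simp [h0 x hx, h0 y hy]
  case d7 p q =>
    simp only [iff_true]
    intro x hx y hy
    refine ⟨q * y 3, -q * x 3, ?_⟩
    rw [algebra_bracket, codifferential_d7]
    ext i
    fin_cases i <;> simp [h0 x hx, h0 y hy] <;> ring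

end ModuliPoint

namespace ModuliPoint

open LieSuperalgebra

/-- The scalar by which `x` acts on the odd part. -/
noncomputable def oddWeight (m : ModuliPoint) (x : Fin 4 → ℂ) : ℂ :=
  m.algebra.bracket x ![1, 0, 0, 0] 0

/-- The trace of the adjoint action of `x`. -/
noncomputable def adTrace (m : ModuliPoint) (x : Fin 4 → ℂ) : ℂ :=
  LinearMap.trace ℂ _ (m.algebra.bracket x)

/-- The trace of the square of the adjoint action of `x`. -/
noncomputable def adSqTrace (m : ModuliPoint) (x : Fin 4 → ℂ) : ℂ :=
  LinearMap.trace ℂ _ (m.algebra.bracket x ∘ₗ m.algebra.bracket x)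

theorem exists_equiv_of_isomorphic {m m' : ModuliPoint}
    (h : m.algebra.Isomorphic m'.algebra) : ∃ e : (Fin 4 → ℂ) ≃ₗ[ℂ] (Fin 4 → ℂ),
      (∀ x, x 0 = 0 ↔ e x 0 = 0) ∧ ∀ x, x 0 = 0 → m'.oddWeight (e x) = m.oddWeight x ∧
        m'.adTrace (e x) = m.adTrace x ∧ m'.adSqTrace (e x) = m.adSqTrace x := by
  obtain ⟨e, he⟩ := h
  have hgrade : ∀ (m : ModuliPoint) (x : Fin 4 → ℂ), x ∈ m.algebra.grade 0 ↔ x 0 = 0 := by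
    intro m x
    refine ⟨fun hx => ((mem_gradeL 0 x).1 hx).1 (by decide), fun hx =>
      (mem_gradeL 0 x).2 ⟨fun _ => hx, fun h => absurd rfl h⟩⟩
  have hconj : ∀ x, m'.algebra.bracket (e x) = e.conj (m.algebra.bracket x) := by
    intro x
    refine LinearMap.ext fun y => ?_
    rw [LinearEquiv.conj_apply_apply]
    have := he.2 x (e.symm y)
    simpa using this.symm
  refine ⟨e, fun x => ⟨fun hx => ?_, fun hx => ?_⟩, fun x hx => ⟨?_, ?_, ?_⟩⟩
  · exact (hgrade m' _).1 (he.1 0 x ((hgrade m x).2 hx))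
  · have := (hgrade m _).1 (he.symm.1 0 (e x) ((hgrade m' _).2 hx))
    simpa using this
  · set f : Fin 4 → ℂ := ![1, 0, 0, 0] with hf
    have hodd : ∀ v : Fin 4 → ℂ, v ∈ gradeL 1 → v = v 0 • f := by
      intro v hv
      obtain ⟨h1, h2, h3⟩ := ((mem_gradeL 1 v).1 hv).2 (by decide)
      ext i
      fin_cases i <;> simp [hf, h1, h2, h3]
    have hef := hodd _ (he.1 1 f (single_mem_odd m))
    have hxf := hodd _ (m.algebra.bracket_mem 0 1 x f ((hgrade m x).2 hx) (single_mem_odd m))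
    have hs : e f 0 ≠ 0 := by
      intro hs
      have : e f = 0 := by
        change e f = e f 0 • f at hef
        rw [hef, hs, zero_smul]
      have := congrFun ((map_eq_zero_iff e e.injective).1 this) 0
      simp [hf] at this
    have h2 := he.2 x f
    change e f = e f 0 • f at hef
    change e (m.algebra.bracket x f) = m'.algebra.bracket (e x) (e f) at h2
    rw [hxf, map_smul, hef, map_smul] at h2
    have h3 := congrFun h2 0
    simp only [Pi.smul_apply, smul_eq_mul] at h3
    have hf0 : f 0 = 1 := rfl
    rw [hf0, mul_one, mul_comm] at h3
    exact (mul_left_cancel₀ hs h3).symm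
  · rw [adTrace, hconj, LinearMap.trace_conj', adTrace]
  · rw [adSqTrace, hconj, ← LinearEquiv.conj_comp, LinearMap.trace_conj', adSqTrace]

theorem trace_fin_four (f : (Fin 4 → ℂ) →ₗ[ℂ] (Fin 4 → ℂ)) : LinearMap.trace ℂ _ f =
    f ![1, 0, 0, 0] 0 + f ![0, 1, 0, 0] 1 + f ![0, 0, 1, 0] 2 + f ![0, 0, 0, 1] 3 := by
  have h0 : Pi.single (0 : Fin 4) (1 : ℂ) = ![1, 0, 0, 0] := by
    ext i; fin_cases i <;> rfl
  have h1 : Pi.single (1 : Fin 4) (1 : ℂ) = ![0, 1, 0, 0] := by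
    ext i; fin_cases i <;> rfl
  have h2 : Pi.single (2 : Fin 4) (1 : ℂ) = ![0, 0, 1, 0] := by
    ext i; fin_cases i <;> rfl
  have h3 : Pi.single (3 : Fin 4) (1 : ℂ) = ![0, 0, 0, 1] := by
    ext i; fin_cases i <;> rfl
  rw [LinearMap.trace_eq_matrix_trace ℂ (Pi.basisFun ℂ (Fin 4)), Matrix.trace, Fin.sum_univ_four]
  simp [h0, h1, h2, h3]

theorem oddWeight_d2 (p q : ℂ) (x : Fin 4 → ℂ) : (d2 p q).oddWeight x = p * x 3 := by
  simp [oddWeight, algebra_bracket, codifferential_d2]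

theorem oddWeight_d3 (x : Fin 4 → ℂ) : d3.oddWeight x = x 3 := by
  simp [oddWeight, algebra_bracket, codifferential_d3]

theorem oddWeight_d4 (x : Fin 4 → ℂ) : d4.oddWeight x = 0 := by
  simp [oddWeight, algebra_bracket, codifferential_d4]

theorem oddWeight_d5 (x : Fin 4 → ℂ) : d5.oddWeight x = x 3 := by
  simp [oddWeight, algebra_bracket, codifferential_d5]

theorem oddWeight_d6 (p q r : ℂ) (x : Fin 4 → ℂ) : (d6 p q r).oddWeight x = p * x 3 := by
  simp [oddWeight, algebra_bracket, codifferential_d6]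

theorem oddWeight_d7 (p q : ℂ) (x : Fin 4 → ℂ) : (d7 p q).oddWeight x = p * x 3 := by
  simp [oddWeight, algebra_bracket, codifferential_d7]

theorem adTrace_d2 (p q : ℂ) (x : Fin 4 → ℂ) : (d2 p q).adTrace x = (3 * p - q) * x 3 := by
  simp only [adTrace, trace_fin_four, algebra_bracket, codifferential_d2, Matrix.cons_val]
  ring

theorem adTrace_d5 (x : Fin 4 → ℂ) : d5.adTrace x = x 3 - x 2 := by
  simp only [adTrace, trace_fin_four, algebra_bracket, codifferential_d5, Matrix.cons_val]
  ring

theorem adTrace_d6 (p q r : ℂ) (x : Fin 4 → ℂ) : (d6 p q r).adTrace x = (p - q - r) * x 3 := by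
  simp only [adTrace, trace_fin_four, algebra_bracket, codifferential_d6, Matrix.cons_val]
  ring

theorem adTrace_d7 (p q : ℂ) (x : Fin 4 → ℂ) : (d7 p q).adTrace x = (p - 2 * q) * x 3 := by
  simp only [adTrace, trace_fin_four, algebra_bracket, codifferential_d7, Matrix.cons_val]
  ring

theorem adSqTrace_d6 (p q r : ℂ) (x : Fin 4 → ℂ) :
    (d6 p q r).adSqTrace x = (p ^ 2 + q ^ 2 + r ^ 2) * x 3 ^ 2 := by
  simp only [adSqTrace, trace_fin_four, LinearMap.comp_apply, algebra_bracket, codifferential_d6,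
    Matrix.cons_val]
  ring

theorem d5_not_isomorphic_d6 (p q r : ℂ) : ¬ d5.algebra.Isomorphic (d6 p q r).algebra := by
  intro h
  obtain ⟨e, he, hinv⟩ := exists_equiv_of_isomorphic h
  obtain ⟨h1, -, -⟩ := hinv ![0, 0, 0, 1] rfl
  obtain ⟨h2, h3, -⟩ := hinv ![0, 0, 1, 0] rfl
  rw [oddWeight_d6, oddWeight_d5] at h1 h2
  rw [adTrace_d6, adTrace_d5] at h3
  simp only [Matrix.cons_val] at h1 h2 h3
  have hp : p ≠ 0 := by
    rintro rfl
    simp at h1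
  rw [(mul_eq_zero.1 h2).resolve_left hp] at h3
  simp at h3

theorem d3_not_isomorphic_d4 : ¬ d3.algebra.Isomorphic d4.algebra := by
  intro h
  obtain ⟨e, he, hinv⟩ := exists_equiv_of_isomorphic h
  obtain ⟨h1, -, -⟩ := hinv ![0, 0, 0, 1] rfl
  rw [oddWeight_d3, oddWeight_d4] at h1
  simp at h1

theorem exists_last_ne_zero {e : (Fin 4 → ℂ) ≃ₗ[ℂ] (Fin 4 → ℂ)}
    (he : ∀ x, x 0 = 0 ↔ e x 0 = 0) (h3 : e ![0, 0, 0, 1] 3 = 0) :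
    ∃ x : Fin 4 → ℂ, x 0 = 0 ∧ x 3 = 0 ∧ e x 3 ≠ 0 := by
  have hs : e (e.symm ![0, 0, 0, 1]) = ![0, 0, 0, 1] := e.apply_symm_apply _
  refine ⟨e.symm ![0, 0, 0, 1] - e.symm ![0, 0, 0, 1] 3 • ![0, 0, 0, 1], ?_, by simp, ?_⟩
  · rw [he, map_sub, map_smul, hs]
    have := (he ![0, 0, 0, 1]).1 rfl
    simp [this]
  · rw [map_sub, map_smul, hs]
    simp [h3]

theorem same_of_isomorphic_d2 {p q p' q' : ℂ}
    (h : (d2 p q).algebra.Isomorphic (d2 p' q').algebra) : (d2 p q).Same (d2 p' q') := by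
  obtain ⟨e, he, hinv⟩ := exists_equiv_of_isomorphic h
  simp only [oddWeight_d2, adTrace_d2] at hinv
  obtain ⟨h1, h2, -⟩ := hinv ![0, 0, 0, 1] rfl
  simp only [Matrix.cons_val, mul_one] at h1 h2
  by_cases hk : e ![0, 0, 0, 1] 3 = 0
  · rw [hk] at h1 h2
    obtain ⟨x, hx0, hx3, hx⟩ := exists_last_ne_zero he hk
    obtain ⟨h3, h4, -⟩ := hinv x hx0
    rw [hx3, mul_zero] at h3 h4
    have hp' := (mul_eq_zero.1 h3).resolve_right hx
    have hq' := (mul_eq_zero.1 h4).resolve_right hx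
    refine ⟨1, one_ne_zero, ?_, ?_⟩
    · linear_combination hp' + h1
    · linear_combination 3 * hp' - hq' + 3 * h1 - h2
  · refine ⟨(e ![0, 0, 0, 1] 3)⁻¹, inv_ne_zero hk, ?_, ?_⟩
    · field_simp
      linear_combination h1
    · field_simp
      linear_combination 3 * h1 - h2

theorem same_of_isomorphic_d7 {p q p' q' : ℂ}
    (h : (d7 p q).algebra.Isomorphic (d7 p' q').algebra) : (d7 p q).Same (d7 p' q') := by
  obtain ⟨e, he, hinv⟩ := exists_equiv_of_isomorphic h
  simp only [oddWeight_d7, adTrace_d7] at hinv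
  obtain ⟨h1, h2, -⟩ := hinv ![0, 0, 0, 1] rfl
  simp only [Matrix.cons_val, mul_one] at h1 h2
  by_cases hk : e ![0, 0, 0, 1] 3 = 0
  · rw [hk] at h1 h2
    obtain ⟨x, hx0, hx3, hx⟩ := exists_last_ne_zero he hk
    obtain ⟨h3, h4, -⟩ := hinv x hx0
    rw [hx3, mul_zero] at h3 h4
    have hp' := (mul_eq_zero.1 h3).resolve_right hx
    have hq' := (mul_eq_zero.1 h4).resolve_right hx
    refine ⟨1, one_ne_zero, ?_, ?_⟩
    · linear_combination hp' + h1
    · linear_combination (hp' - hq' + h1 - h2) / 2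
  · refine ⟨(e ![0, 0, 0, 1] 3)⁻¹, inv_ne_zero hk, ?_, ?_⟩
    · field_simp
      linear_combination h1
    · field_simp
      linear_combination (h1 - h2) / 2

theorem eq_zero_of_add_of_sq_add {q r : ℂ} (h1 : q + r = 0) (h2 : q ^ 2 + r ^ 2 = 0) :
    q = 0 ∧ r = 0 := by
  have hr : r = -q := by linear_combination h1
  have hq : q ^ 2 = 0 := by rw [hr] at h2; linear_combination h2 / 2
  have hq0 : q = 0 := by simpa using hq
  exact ⟨hq0, by rw [hr, hq0, neg_zero]⟩

theorem same_of_isomorphic_d6 {p q r p' q' r' : ℂ}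
    (h : (d6 p q r).algebra.Isomorphic (d6 p' q' r').algebra) :
    (d6 p q r).Same (d6 p' q' r') := by
  obtain ⟨e, he, hinv⟩ := exists_equiv_of_isomorphic h
  simp only [oddWeight_d6, adTrace_d6, adSqTrace_d6] at hinv
  obtain ⟨h1, h2, h3⟩ := hinv ![0, 0, 0, 1] rfl
  simp only [Matrix.cons_val, mul_one, one_pow] at h1 h2 h3
  by_cases hk : e ![0, 0, 0, 1] 3 = 0
  · rw [hk] at h1 h2 h3
    obtain ⟨x, hx0, hx3, hx⟩ := exists_last_ne_zero he hk
    obtain ⟨h4, h5, h6⟩ := hinv x hx0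
    rw [hx3] at h4 h5 h6
    have hp : p = 0 := by linear_combination -h1
    have hp' : p' = 0 := by simpa [hx] using h4
    obtain ⟨hq, hr⟩ := eq_zero_of_add_of_sq_add (q := q) (r := r)
      (by linear_combination hp + h2) (by linear_combination -h3 - p * hp)
    have h5' : p' - q' - r' = 0 := by simpa [hx] using h5
    have h6' : p' ^ 2 + q' ^ 2 + r' ^ 2 = 0 := by simpa [hx] using h6
    obtain ⟨hq', hr'⟩ := eq_zero_of_add_of_sq_add (q := q') (r := r')
      (by linear_combination hp' - h5') (by linear_combination h6' - p' * hp')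
    exact ⟨1, one_ne_zero, by simp [hp, hp'], Or.inl ⟨by simp [hq, hq'], by simp [hr, hr']⟩⟩
  · generalize e ![0, 0, 0, 1] 3 = k at *
    have hs : (q' + r') * k = q + r := by linear_combination h1 - h2
    have hprod : (q' * k - q) * (q' * k - r) = 0 := by
      linear_combination (q' * k - (q' * k + r' * k + q + r) / 2) * hs +
        (h3 - (p' * k + p) * h1) / 2
    refine ⟨k⁻¹, inv_ne_zero hk, by field_simp; linear_combination h1, ?_⟩
    rcases mul_eq_zero.1 hprod with h0 | h0
    · left
      constructor
      · field_simp
        linear_combination h0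
      · field_simp
        linear_combination hs - h0
    · right
      constructor
      · field_simp
        linear_combination h0
      · field_simp
        linear_combination hs - h0

theorem isomorphic_iff_same (m m' : ModuliPoint) :
    m.algebra.Isomorphic m'.algebra ↔ m.Same m' := by
  refine ⟨fun h => ?_, Same.isomorphic⟩
  have hodd : OddAbelian m.algebra ↔ OddAbelian m'.algebra :=
    ⟨fun hm => hm.of_isomorphic h.symm, fun hm => hm.of_isomorphic h⟩
  have hplanar : EvenPlanar m.algebra ↔ EvenPlanar m'.algebra :=
    ⟨fun hm => hm.of_isomorphic h.symm, fun hm => hm.of_isomorphic h⟩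
  have hsol : m.algebra.IsSolvable ↔ m'.algebra.IsSolvable :=
    ⟨h.symm.isSolvable, h.isSolvable⟩
  have hiff : ∀ m : ModuliPoint, m.algebra.IsSolvable ↔ m ≠ d1 := fun m =>
    ⟨by rintro hm rfl; exact not_isSolvable_d1 hm, isSolvable_algebra⟩
  rw [hiff, hiff] at hsol
  rw [oddAbelian_iff, oddAbelian_iff] at hodd
  rw [evenPlanar_iff, evenPlanar_iff] at hplanar
  cases m <;> cases m' <;> simp at hodd hplanar hsol
  case d1.d1 => trivial
  case d2.d2 => exact same_of_isomorphic_d2 h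
  case d3.d3 => trivial
  case d3.d4 => exact d3_not_isomorphic_d4 h
  case d4.d3 => exact d3_not_isomorphic_d4 h.symm
  case d4.d4 => trivial
  case d5.d5 => trivial
  case d5.d6 => exact d5_not_isomorphic_d6 _ _ _ h
  case d6.d5 => exact d5_not_isomorphic_d6 _ _ _ h.symm
  case d6.d6 => exact same_of_isomorphic_d6 h
  case d7.d7 => exact same_of_isomorphic_d7 h

end ModuliPoint

theorem mainTheorem2 :
    -- every algebra of the list is a Lie superalgebra of bidimension `3|1`
    (∀ m : ModuliPoint, m.algebra.HasBidim 3 1) ∧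
    -- the list is complete
    (∀ (L : Type u) [AddCommGroup L] [Module ℂ L] (A : LieSuperalgebra L),
      A.HasBidim 3 1 → ∃ m : ModuliPoint, A.Isomorphic m.algebra) ∧
    -- the only isomorphisms are those between identified labels
    (∀ m m' : ModuliPoint, m.algebra.Isomorphic m'.algebra ↔ m.Same m') ∧
    -- `d1` is nonsolvable, and an extension of `sl(2, ℂ)` by the trivial `0|1` algebra
    (¬ ModuliPoint.d1.algebra.IsSolvable ∧
      ModuliPoint.d1.algebra.IsExtension LieSuperalgebra.sl2
        (LieSuperalgebra.trivialAlgebra 0 1)) ∧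
    -- every other algebra is solvable, and an extension of the trivial `1|0` algebra by a
    -- solvable `2|1` algebra
    (∀ (L : Type u) [AddCommGroup L] [Module ℂ L] (A : LieSuperalgebra L),
      A.HasBidim 3 1 → ¬ A.Isomorphic ModuliPoint.d1.algebra →
        A.IsSolvable ∧
        ∃ (M : Type u) (_ : AddCommGroup M) (_ : Module ℂ M) (B : LieSuperalgebra M),
          B.HasBidim 2 1 ∧ B.IsSolvable ∧
            A.IsExtension (LieSuperalgebra.trivialAlgebra 1 0) B) :=
  ⟨ModuliPoint.hasBidim_algebra, fun _ _ _ _ hA => LieSuperalgebra.exists_isomorphic hA,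
    ModuliPoint.isomorphic_iff_same, ⟨ModuliPoint.not_isSolvable_d1, ModuliPoint.isExtension_d1⟩,
    fun _ _ _ _ hA h => LieSuperalgebra.isSolvable_and_exists_isExtension hA h⟩
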